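/- Let $\mathbb{F}$ be a field of characteristic $0$. The tetrahedron algebra $\boxtimes$ is the Lie algebra over $\mathbb{F}$ with generators $x_{ij}$ ($i,j\in\{0,1,2,3\}$, $i\neq j$) and relations: $x_{ij}+x_{ji}=0$ for distinct $i,j$; $[x_{hi},x_{ij}]=2x_{hi}+2x_{ij}$ for mutually distinct $h,i,j$; $[x_{hi},[x_{hi},[x_{hi},x_{jk}]]]=4[x_{hi},x_{jk}]$ for mutually distinct $h,i,j,k$. For distinct $i,j$, an element $\xi\in\boxtimes$ is called $x_{ij}$-like if $[x_{ij},\xi]=0$ and $[x_{hk},[x_{hk},[x_{hk},\xi]]]=4[x_{hk},\xi]$, where $h,i,j,k$ are mutually distinct; let $X_{ij}$ be the set of $x_{ij}$-like elements. Let $\mathfrak{sl}_2$ be the Lie algebra of trace-zero $2\times 2$ matrices over $\mathbb{F}$, with basis $e,f,h$ satisfying $[h,e]=2e$, $[h,f]=-2f$, $[e,f]=h$, where $e=\begin{pmatrix}0&1\\0&0\end{pmatrix}$, $f=\begin{pmatrix}0&0\\1&0\end{pmatrix}$, $h=\begin{pmatrix}1&0\\0&-1\end{pmatrix}$, and put $x=2e-h$,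 $y=-2f-h$, $z=h$. Let $\mathcal{A}=\mathbb{F}[t,t^{-1},(t-1)^{-1}]$, $t'=1-t^{-1}$, $t''=(1-t)^{-1}$, and let $L(\mathfrak{sl}_2)^+=\mathfrak{sl}_2\otimes_{\mathbb{F}}\mathcal{A}$ with bracket $[u\otimes a,v\otimes b]=[u,v]\otimes ab$, regarded as an $\mathcal{A}$-module via $(u\otimes a)b=u\otimes ab$. Then the following hold. (i) For all distinct $i,j$, the set $X_{ij}$ is an $\mathbb{F}$-subspace of $\boxtimes$, and $\boxtimes=X_{12}\oplus X_{23}\oplus X_{31}$ as an $\mathbb{F}$-vector space. (ii) There is a unique Lie algebra isomorphism $\sigma:\boxtimes\to L(\mathfrak{sl}_2)^+$ that sends $$x_{12}\mapsto x\otimes 1,\quad x_{23}\mapsto y\otimes 1,\quad x_{31}\mapsto z\otimes 1,$$ $$x_{03}\mapsto y\otimes t+z\otimes(t-1),\quad x_{01}\mapsto z\otimes t'+x\otimes(t'-1),\quad x_{02}\mapsto x\otimes t''+y\otimes(t''-1).$$ Writing $X_{ij}^\sigma$ and $x_{ij}^\sigma$ for the images of $X_{ij}$ and $x_{ij}$ under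 $\sigma$, we have $$X_{12}^\sigma=x\otimes\mathcal{A},\quad X_{23}^\sigma=y\otimes\mathcal{A},\quad X_{31}^\sigma=z\otimes\mathcal{A},$$ $$X_{03}^\sigma=(y\otimes t+z\otimes(t-1))\mathcal{A},\quad X_{01}^\sigma=(z\otimes t'+x\otimes(t'-1))\mathcal{A},\quad X_{02}^\sigma=(x\otimes t''+y\otimes(t''-1))\mathcal{A},$$ and $X_{ij}^\sigma=x_{ij}^\sigma\mathcal{A}$ for all distinct $i,j\in\{0,1,2,3\}$. -/

import Mathlib

open scoped TensorProduct

noncomputable section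

namespace TetAlg

/-- Index set of the twelve standard generators: ordered pairs of distinct elements
of `{0, 1, 2, 3}`. -/
abbrev Gen : Type := {p : Fin 4 × Fin 4 // p.1 ≠ p.2}

/-- The free generator with indices `i ≠ j` of the free Lie algebra on `Gen`. -/
def freeX (F : Type*) [Field F] (i j : Fin 4) (hij : i ≠ j) : FreeLieAlgebra F Gen :=
  FreeLieAlgebra.of F ⟨(i, j), hij⟩

/-- The defining relators of the tetrahedron algebra. -/
inductive Relator (F : Type*) [Field F] : FreeLieAlgebra F Gen → Prop
  | antisymm (i j : Fin 4) (hij : i ≠ j) :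
      Relator F (freeX F i j hij + freeX F j i hij.symm)
  | triangle (h i j : Fin 4) (hhi : h ≠ i) (hij : i ≠ j) (hhj : h ≠ j) :
      Relator F (⁅freeX F h i hhi, freeX F i j hij⁆
        - ((2 : F) • freeX F h i hhi + (2 : F) • freeX F i j hij))
  | dolanGrady (h i j k : Fin 4) (hhi : h ≠ i) (hhj : h ≠ j) (hhk : h ≠ k)
      (hij : i ≠ j) (hik : i ≠ k) (hjk : j ≠ k) :
      Relator F (⁅freeX F h i hhi, ⁅freeX F h i hhi, ⁅freeX F h i hhi, freeX F j k hjk⁆⁆⁆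
        - (4 : F) • ⁅freeX F h i hhi, freeX F j k hjk⁆)

/-- The Lie ideal of the free Lie algebra generated by the relators. -/
def relIdeal (F : Type*) [Field F] : LieIdeal F (FreeLieAlgebra F Gen) :=
  LieSubmodule.lieSpan F (FreeLieAlgebra F Gen) {r | Relator F r}

/-- The tetrahedron algebra, presented by generators and relations. -/
def Tet (F : Type*) [Field F] : Type _ := FreeLieAlgebra F Gen ⧸ relIdeal F

instance (F : Type*) [Field F] : LieRing (Tet F) :=
  inferInstanceAs (LieRing (FreeLieAlgebra F Gen ⧸ relIdeal F))

instance (F : Type*) [Field F] : LieAlgebra F (Tet F) :=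
  inferInstanceAs (LieAlgebra F (FreeLieAlgebra F Gen ⧸ relIdeal F))

/-- The standard generator `x_{ij}` of the tetrahedron algebra. -/
def gen (F : Type*) [Field F] (i j : Fin 4) (hij : i ≠ j := by decide) : Tet F :=
  LieSubmodule.Quotient.mk (N := relIdeal F) (freeX F i j hij)

/-- `ξ` is `x_{ij}`-like: it commutes with `x_{ij}` and satisfies the Dolan-Grady relation with
`x_{hk}` whenever `h, i, j, k` are mutually distinct. -/
def IsLike (F : Type*) [Field F] (i j : Fin 4) (hij : i ≠ j) (ξ : Tet F) : Prop :=
  ⁅gen F i j hij, ξ⁆ = 0 ∧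
  ∀ (h k : Fin 4) (hhk : h ≠ k), h ≠ i → h ≠ j → k ≠ i → k ≠ j →
    ⁅gen F h k hhk, ⁅gen F h k hhk, ⁅gen F h k hhk, ξ⁆⁆⁆ = (4 : F) • ⁅gen F h k hhk, ξ⁆

/-- The set `X_{ij}` of all `x_{ij}`-like elements. -/
def likeSet (F : Type*) [Field F] (i j : Fin 4) (hij : i ≠ j := by decide) : Set (Tet F) :=
  {ξ | IsLike F i j hij ξ}

/-- The Lie algebra of trace zero `2 × 2` matrices. -/
abbrev sl2 (F : Type*) [Field F] : Type _ := LieAlgebra.SpecialLinear.sl (Fin 2) F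

/-- The matrix with rows `(0, 1)` and `(0, 0)`. -/
def sl2e (F : Type*) [Field F] : sl2 F :=
  LieAlgebra.SpecialLinear.single (0 : Fin 2) 1 (by decide) (1 : F)

/-- The matrix with rows `(0, 0)` and `(1, 0)`. -/
def sl2f (F : Type*) [Field F] : sl2 F :=
  LieAlgebra.SpecialLinear.single (1 : Fin 2) 0 (by decide) (1 : F)

/-- The matrix with rows `(1, 0)` and `(0, -1)`. -/
def sl2h (F : Type*) [Field F] : sl2 F :=
  LieAlgebra.SpecialLinear.singleSubSingle (0 : Fin 2) 1 (1 : F)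

/-- First element of the equitable basis. -/
def eqx (F : Type*) [Field F] : sl2 F := (2 : F) • sl2e F - sl2h F

/-- Second element of the equitable basis. -/
def eqy (F : Type*) [Field F] : sl2 F := -((2 : F) • sl2f F) - sl2h F

/-- Third element of the equitable basis. -/
def eqz (F : Type*) [Field F] : sl2 F := sl2h F

/-- The algebra `F[t, t⁻¹, (t - 1)⁻¹]`, as the localization of `F[t]` at `t (t - 1)`. -/
abbrev A (F : Type*) [Field F] : Type _ :=
  Localization.Away (Polynomial.X * (Polynomial.X - 1) : Polynomial F)

/-- The indeterminate `t`. -/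
def t (F : Type*) [Field F] : A F := algebraMap (Polynomial F) (A F) Polynomial.X

/-- The inverse of `t (t - 1)`. -/
def invD (F : Type*) [Field F] : A F :=
  IsLocalization.Away.invSelf (Polynomial.X * (Polynomial.X - 1) : Polynomial F)

theorem t_mul_invD (F : Type*) [Field F] : t F * (t F - 1) * invD F = 1 := by
  have h := IsLocalization.Away.mul_invSelf (S := A F)
    (Polynomial.X * (Polynomial.X - 1) : Polynomial F)
  rw [map_mul, map_sub, map_one] at h
  exact h

/-- The inverse of `t`. -/
def tInv (F : Type*) [Field F] : A F := (t F - 1) * invD F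

/-- The inverse of `1 - t`. -/
def oneSubTInv (F : Type*) [Field F] : A F := -(t F * invD F)

theorem t_mul_tInv (F : Type*) [Field F] : t F * tInv F = 1 := by
  rw [tInv, ← mul_assoc, t_mul_invD]

theorem one_sub_t_mul_inv (F : Type*) [Field F] : (1 - t F) * oneSubTInv F = 1 := by
  have h := t_mul_invD F
  rw [oneSubTInv]
  linear_combination h

/-- `t' = 1 - t⁻¹`. -/
def t' (F : Type*) [Field F] : A F := 1 - tInv F

/-- `t'' = (1 - t)⁻¹`. -/
def t'' (F : Type*) [Field F] : A F := oneSubTInv F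

/-- The three-point loop algebra of `sl2`. The tensor factors are in Mathlib's order: the pure
tensor of `u` in `sl2` and `a` in `A` is `a ⊗ₜ u`, the bracket is
`⁅a ⊗ₜ u, b ⊗ₜ v⁆ = (a * b) ⊗ₜ ⁅u, v⁆`, and `A` acts by `b • (a ⊗ₜ u) = (b * a) ⊗ₜ u`. -/
abbrev Loop (F : Type*) [Field F] : Type _ := A F ⊗[F] sl2 F

/-- The values of a Lie algebra isomorphism from the tetrahedron algebra to the three-point loop
algebra on the standard generators `x_{12}, x_{23}, x_{31}, x_{03}, x_{01}, x_{02}`. -/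
def HasStandardValues (F : Type*) [Field F] (σ : Tet F ≃ₗ⁅F⁆ Loop F) : Prop :=
  σ (gen F 1 2) = (1 : A F) ⊗ₜ[F] eqx F ∧
  σ (gen F 2 3) = (1 : A F) ⊗ₜ[F] eqy F ∧
  σ (gen F 3 1) = (1 : A F) ⊗ₜ[F] eqz F ∧
  σ (gen F 0 3) = t F ⊗ₜ[F] eqy F + (t F - 1) ⊗ₜ[F] eqz F ∧
  σ (gen F 0 1) = t' F ⊗ₜ[F] eqz F + (t' F - 1) ⊗ₜ[F] eqx F ∧
  σ (gen F 0 2) = t'' F ⊗ₜ[F] eqx F + (t'' F - 1) ⊗ₜ[F] eqy F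

end TetAlg

end

noncomputable section

namespace TetAlg

/-! ### Brackets and linear maps on `sl2` in the basis `e`, `f`, `h`. -/

section SlTwo

variable {F : Type*} [Field F]

/-! The map from generators to the loop algebra respects the relations: each image is a trace-zero
matrix of determinant -1 over `A F`, so its adjoint action has eigenvalues 0, 2, -2 and satisfies
`ad^3 = 4 ad`; the triangle relations are identities among `t`, `t'`, `t''`. Surjectivity holds
because `sl2` is perfect and `t`, `t'`, `t''` generate `A F`. The substance is injectivity, for
which a left inverse is built.

The generators `x_12`, `x_23`, `x_31` give a map `ι` of `sl2` into the tetrahedron algebra. Relative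
to `ι`, the generator `x_03` yields an equivariant map playing the role of `s ↦ t ⊗ s`, and the
Casimir operator `casimir` iterates it to candidates for `t^n ⊗ s`. The Dolan-Grady relations supply
the one low-degree identity from which `power_good` derives, by induction on degree, that the
bracket multiplies these powers correctly. An order-three rotation of `sl2` treats `x_01` and `x_02`
in the same way, giving powers of `t'` and `t''`.

The remaining triangle relations say `t t' = t - 1`, `t' t'' = t' - 1`, `t'' t = t'' - 1`
(`good_of_triangle`). Hence the span of all these powers, which mirrors the partial fraction basis
of `A F`, is closed under multiplication by `t`, `t'`, `t''` (`isClosedFamily_of_powers`). The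
Casimir operators therefore lie in the centroid, which is commutative, so `A F` maps to the centroid
and `a ⊗ s ↦ φ(a)(ι s)` is the left inverse (`IsClosedFamily.exists_loop_hom`).

After transport to the loop algebra the Dolan-Grady condition on a like element is automatic, and
the centralizer of a matrix of determinant -1 is its `A F`-span; this gives the images and the
direct sum. -/

theorem val_sl2e : (sl2e F).1 = !![0, 1; 0, 0] := by
  rw [sl2e, LieAlgebra.SpecialLinear.val_single]
  ext i j
  fin_cases i <;> fin_cases j <;> simp [Matrix.single]

theorem val_sl2f : (sl2f F).1 = !![0, 0; 1, 0] := by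
  rw [sl2f, LieAlgebra.SpecialLinear.val_single]
  ext i j
  fin_cases i <;> fin_cases j <;> simp [Matrix.single]

theorem val_sl2h : (sl2h F).1 = !![1, 0; 0, -1] := by
  rw [sl2h, LieAlgebra.SpecialLinear.val_singleSubSingle]
  ext i j
  fin_cases i <;> fin_cases j <;> simp [Matrix.single]

theorem lie_h_e : ⁅sl2h F, sl2e F⁆ = (2 : F) • sl2e F := by
  apply Subtype.ext
  rw [LieAlgebra.SpecialLinear.sl_bracket]
  change _ = (2 : F) • (sl2e F).1
  simp only [val_sl2e, val_sl2h]
  ext i j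
  fin_cases i <;> fin_cases j <;> (simp; try norm_num)

theorem lie_h_f : ⁅sl2h F, sl2f F⁆ = -((2 : F) • sl2f F) := by
  apply Subtype.ext
  rw [LieAlgebra.SpecialLinear.sl_bracket]
  change _ = -((2 : F) • (sl2f F).1)
  simp only [val_sl2f, val_sl2h]
  ext i j
  fin_cases i <;> fin_cases j <;> (simp; try norm_num)

theorem lie_e_f : ⁅sl2e F, sl2f F⁆ = sl2h F := by
  apply Subtype.ext
  simp only [LieSubalgebra.coe_bracket, val_sl2e, val_sl2f, val_sl2h, Ring.lie_def]
  ext i j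
  fin_cases i <;> fin_cases j <;> simp

theorem lie_e_h : ⁅sl2e F, sl2h F⁆ = -((2 : F) • sl2e F) := by
  rw [← lie_skew, lie_h_e]

theorem lie_f_h : ⁅sl2f F, sl2h F⁆ = (2 : F) • sl2f F := by
  rw [← lie_skew, lie_h_f, neg_neg]

theorem lie_f_e : ⁅sl2f F, sl2e F⁆ = -sl2h F := by
  rw [← lie_skew, lie_e_f]

/-- The linear map on `sl2` with prescribed values on `e`, `f`, `h`. -/
def sl2Lift {V : Type*} [AddCommGroup V] [Module F V] (a b c : V) : sl2 F →ₗ[F] V where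
  toFun s := s.1 0 1 • a + s.1 1 0 • b + s.1 0 0 • c
  map_add' s s' := by simp [add_smul]; abel
  map_smul' r s := by simp [mul_smul]

variable {V : Type*} [AddCommGroup V] [Module F V]

@[simp] theorem sl2Lift_e (a b c : V) : sl2Lift a b c (sl2e F) = a := by
  simp [sl2Lift, val_sl2e]

@[simp] theorem sl2Lift_f (a b c : V) : sl2Lift a b c (sl2f F) = b := by
  simp [sl2Lift, val_sl2f]

@[simp] theorem sl2Lift_h (a b c : V) : sl2Lift a b c (sl2h F) = c := by
  simp [sl2Lift, val_sl2h]

theorem sl2_eq (s : sl2 F) : s = s.1 0 1 • sl2e F + s.1 1 0 • sl2f F + s.1 0 0 • sl2h F := by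
  have ht : s.1 0 0 + s.1 1 1 = 0 := by
    have : Matrix.trace s.1 = 0 := s.2
    simpa [Matrix.trace, Fin.sum_univ_two] using this
  apply Subtype.ext
  change s.1 = s.1 0 1 • (sl2e F).1 + s.1 1 0 • (sl2f F).1 + s.1 0 0 • (sl2h F).1
  simp only [val_sl2e, val_sl2f, val_sl2h]
  ext i j
  fin_cases i <;> fin_cases j <;> simp
  linear_combination ht

theorem sl2_hom_ext {α β : sl2 F →ₗ[F] V} (he : α (sl2e F) = β (sl2e F))
    (hf : α (sl2f F) = β (sl2f F)) (hh : α (sl2h F) = β (sl2h F)) : α = β := by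
  ext s
  rw [sl2_eq s]
  simp only [map_add, map_smul, he, hf, hh]

theorem sl2_mem_of_basis {S : Submodule F (sl2 F)} (he : sl2e F ∈ S) (hf : sl2f F ∈ S)
    (hh : sl2h F ∈ S) (s : sl2 F) : s ∈ S := by
  rw [sl2_eq s]
  exact S.add_mem (S.add_mem (S.smul_mem _ he) (S.smul_mem _ hf)) (S.smul_mem _ hh)

end SlTwo

/-! ### Linear maps from `sl2` that multiply like loop coefficients. -/

section Good

variable {F : Type*} [Field F] {L : Type*} [LieRing L] [LieAlgebra F L]

/-- The bracket of two linear images of `sl2` is a linear image of the bracket. -/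
def Good (α β γ : sl2 F →ₗ[F] L) : Prop := ∀ a b, ⁅α a, β b⁆ = γ ⁅a, b⁆

/-- The bilinear map measuring the failure of `Good α β γ`. -/
def defect (α β γ : sl2 F →ₗ[F] L) : sl2 F →ₗ[F] sl2 F →ₗ[F] L :=
  LinearMap.mk₂ F (fun a b => ⁅α a, β b⁆ - γ ⁅a, b⁆)
    (fun a b c => by simp only [map_add, add_lie]; abel)
    (fun r a b => by simp only [map_smul, smul_lie, smul_sub])
    (fun a b c => by simp only [map_add, lie_add]; abel)
    (fun r a b => by simp only [map_smul, lie_smul, smul_sub])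

theorem defect_apply (α β γ : sl2 F →ₗ[F] L) (a b : sl2 F) :
    defect α β γ a b = ⁅α a, β b⁆ - γ ⁅a, b⁆ := rfl

theorem good_iff_defect {α β γ : sl2 F →ₗ[F] L} : Good α β γ ↔ defect α β γ = 0 := by
  constructor
  · intro h
    ext a b
    simp [defect_apply, h a b]
  · intro h a b
    rw [← sub_eq_zero, ← defect_apply, h]
    rfl

theorem good_of_basis {α β γ : sl2 F →ₗ[F] L}
    (hee : ⁅α (sl2e F), β (sl2e F)⁆ = 0) (hff : ⁅α (sl2f F), β (sl2f F)⁆ = 0)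
    (hhh : ⁅α (sl2h F), β (sl2h F)⁆ = 0)
    (hef : ⁅α (sl2e F), β (sl2f F)⁆ = γ (sl2h F)) (hfe : ⁅α (sl2f F), β (sl2e F)⁆ = -γ (sl2h F))
    (heh : ⁅α (sl2e F), β (sl2h F)⁆ = -((2 : F) • γ (sl2e F)))
    (hhe : ⁅α (sl2h F), β (sl2e F)⁆ = (2 : F) • γ (sl2e F))
    (hfh : ⁅α (sl2f F), β (sl2h F)⁆ = (2 : F) • γ (sl2f F))
    (hhf : ⁅α (sl2h F), β (sl2f F)⁆ = -((2 : F) • γ (sl2f F))) : Good α β γ := by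
  rw [good_iff_defect]
  apply sl2_hom_ext <;> apply sl2_hom_ext <;>
    simp only [defect_apply, lie_self, lie_h_e, lie_h_f, lie_e_f, lie_e_h, lie_f_h, lie_f_e,
      hee, hff, hhh, hef, hfe, heh, hhe, hfh, hhf, map_zero, map_neg, map_smul, sub_self,
      LinearMap.zero_apply]

theorem Good.symm {α β γ : sl2 F →ₗ[F] L} (h : Good α β γ) : Good β α γ := fun a b => by
  rw [← lie_skew, h, ← lie_skew, map_neg, neg_neg]

theorem Good.add_right {α β β' γ γ' : sl2 F →ₗ[F] L} (h : Good α β γ) (h' : Good α β' γ') :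
    Good α (β + β') (γ + γ') := fun a b => by
  simp only [LinearMap.add_apply, lie_add, h a b, h' a b]

theorem Good.sub_right {α β β' γ γ' : sl2 F →ₗ[F] L} (h : Good α β γ) (h' : Good α β' γ') :
    Good α (β - β') (γ - γ') := fun a b => by
  simp only [LinearMap.sub_apply, lie_sub, h a b, h' a b]

theorem Good.smul_right {α β γ : sl2 F →ₗ[F] L} (r : F) (h : Good α β γ) :
    Good α (r • β) (r • γ) := fun a b => by
  simp only [LinearMap.smul_apply, lie_smul, h a b]

theorem Good.sub_left {α α' β γ γ' : sl2 F →ₗ[F] L} (h : Good α β γ) (h' : Good α' β γ') :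
    Good (α - α') β (γ - γ') := fun a b => by
  simp only [LinearMap.sub_apply, sub_lie, h a b, h' a b]

variable [CharZero F]

/-- Perfectness of `sl2`: each of `e`, `f`, `h` is a scalar multiple of a bracket. -/
theorem sl2_mem_of_lie {S : Submodule F L} {γ : sl2 F →ₗ[F] L}
    (h : ∀ a b : sl2 F, γ ⁅a, b⁆ ∈ S) (s : sl2 F) : γ s ∈ S := by
  have h2 : (2 : F) ≠ 0 := two_ne_zero
  apply sl2_mem_of_basis (S := S.comap γ) <;> rw [Submodule.mem_comap]
  · have := S.smul_mem (2⁻¹ : F) (h (sl2h F) (sl2e F))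
    rwa [lie_h_e, map_smul, smul_smul, inv_mul_cancel₀ h2, one_smul] at this
  · have := S.smul_mem (2⁻¹ : F) (h (sl2f F) (sl2h F))
    rwa [lie_f_h, map_smul, smul_smul, inv_mul_cancel₀ h2, one_smul] at this
  · have := h (sl2e F) (sl2f F)
    rwa [lie_e_f] at this

theorem sl2_hom_ext_lie {γ δ : sl2 F →ₗ[F] L} (h : ∀ a b : sl2 F, γ ⁅a, b⁆ = δ ⁅a, b⁆) : γ = δ := by
  rw [← sub_eq_zero]
  ext s
  have := sl2_mem_of_lie (S := ⊥) (γ := γ - δ) (fun a b => by simp [h a b]) s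
  simpa using this

/-- Associativity, from the Jacobi identity. -/
theorem Good.assoc {α β γ p q r s : sl2 F →ₗ[F] L} (hp : Good α β p) (hq : Good β γ q)
    (hr : Good α γ r) (hps : Good p γ s) (hrs : Good β r s) : Good α q s := by
  intro a b
  have key : ∀ b c : sl2 F, ⁅α a, q ⁅b, c⁆⁆ = s ⁅a, ⁅b, c⁆⁆ := by
    intro b c
    rw [← hq, leibniz_lie, hp, hr, hps, hrs, ← map_add, ← leibniz_lie]
  have := sl2_hom_ext_lie (γ := LieAlgebra.ad F L (α a) ∘ₗ q)
    (δ := s ∘ₗ LieAlgebra.ad F (sl2 F) a) (fun b c => by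
      simpa using key b c)
  simpa using LinearMap.congr_fun this b

/-- An equivariant map is determined by its value at `f`. -/
theorem equivariant_ext {ι α β : sl2 F →ₗ[F] L} (hα : Good ι α α) (hβ : Good ι β β)
    (h : α (sl2f F) = β (sl2f F)) : α = β := by
  have h2 : (2 : F) ≠ 0 := two_ne_zero
  have hh : α (sl2h F) = β (sl2h F) := by
    rw [← lie_e_f, ← hα, ← hβ, h]
  refine sl2_hom_ext ?_ h hh
  have h1 : -((2 : F) • α (sl2e F)) = -((2 : F) • β (sl2e F)) := by
    rw [← map_smul, ← map_smul, ← map_neg, ← map_neg, ← lie_e_h, ← hα, ← hβ, hh]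
  exact smul_right_injective L h2 (neg_injective h1)

/-- Multiplication operators commute, from the Jacobi identity. -/
theorem Good.comm {α β γ p q r s : sl2 F →ₗ[F] L} {ι : sl2 F →ₗ[F] L} (hr : Good β γ r)
    (hs : Good α r s) (hp : Good α γ p) (hq : Good β p q) (hαβ : ∃ w, Good α β w)
    (hιs : Good ι s s) (hιq : Good ι q q) : s = q := by
  obtain ⟨w, hw⟩ := hαβ
  have h4 : (2 * 2 : F) ≠ 0 := by norm_num
  apply equivariant_ext hιs hιq
  -- With `h` in both outer slots the commutator term is `w ⁅h, h⁆ = 0`, so both orders of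
  -- multiplication agree at `f`.
  have h1 := leibniz_lie (α (sl2h F)) (β (sl2h F)) (γ (sl2f F))
  rw [hr, hs, hw, hp, hq, lie_self, map_zero, zero_lie, zero_add, lie_h_f, lie_neg, lie_smul,
    lie_h_f, smul_neg, neg_neg, smul_smul, map_smul, map_smul] at h1
  exact smul_right_injective L h4 h1

end Good

/-! ### Equivariant maps and the Casimir operator. -/

section Equivariant

variable {F : Type*} [Field F] {L : Type*} [LieRing L] [LieAlgebra F L]
  {ι α β γ : sl2 F →ₗ[F] L}

theorem lie_lie_of_equivariant (hα : Good ι α α) (hβ : Good ι β β) (c a b : sl2 F) :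
    ⁅ι c, ⁅α a, β b⁆⁆ = ⁅α ⁅c, a⁆, β b⁆ + ⁅α a, β ⁅c, b⁆⁆ := by
  rw [leibniz_lie, hα, hβ]

theorem lie_hf_of_ff (hα : Good ι α α) (hβ : Good ι β β)
    (h : ⁅α (sl2f F), β (sl2f F)⁆ = 0) :
    ⁅α (sl2h F), β (sl2f F)⁆ = -⁅α (sl2f F), β (sl2h F)⁆ := by
  have := lie_lie_of_equivariant hα hβ (sl2e F) (sl2f F) (sl2f F)
  rw [h, lie_zero, lie_e_f] at this
  exact eq_neg_of_add_eq_zero_left this.symm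

/-- The operator on `L` which is multiplication by `α`, built from the split Casimir element. -/
def casimir (ι α : sl2 F →ₗ[F] L) : L →ₗ[F] L :=
  (4⁻¹ : F) • (LieAlgebra.ad F L (α (sl2e F)) ∘ₗ LieAlgebra.ad F L (ι (sl2f F)) +
    LieAlgebra.ad F L (α (sl2f F)) ∘ₗ LieAlgebra.ad F L (ι (sl2e F)) +
    (2⁻¹ : F) • (LieAlgebra.ad F L (α (sl2h F)) ∘ₗ LieAlgebra.ad F L (ι (sl2h F))))

theorem casimir_apply (ι α : sl2 F →ₗ[F] L) (v : L) : casimir ι α v =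
    (4⁻¹ : F) • (⁅α (sl2e F), ⁅ι (sl2f F), v⁆⁆ + ⁅α (sl2f F), ⁅ι (sl2e F), v⁆⁆ +
      (2⁻¹ : F) • ⁅α (sl2h F), ⁅ι (sl2h F), v⁆⁆) := rfl

variable [CharZero F]

/-- The vector `f ⊗ e` generates the `sl2`-module `sl2 ⊗ sl2`. -/
theorem good_of_fe (hα : Good ι α α) (hβ : Good ι β β) (hγ : Good ι γ γ)
    (h : ⁅α (sl2f F), β (sl2e F)⁆ = -γ (sl2h F)) : Good α β γ := by
  -- The defect is an equivariant bilinear map, so its vanishing spreads from `f ⊗ e` along the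
  -- action of `sl2`.
  have hB : ∀ c a b, ⁅ι c, defect α β γ a b⁆ =
      defect α β γ ⁅c, a⁆ b + defect α β γ a ⁅c, b⁆ := by
    intro c a b
    rw [defect_apply, lie_sub, lie_lie_of_equivariant hα hβ, hγ, leibniz_lie c a b, map_add,
      defect_apply, defect_apply]
    abel
  have h2 : (2 : F) ≠ 0 := two_ne_zero
  rw [good_iff_defect]
  generalize hBd : defect α β γ = B at hB
  have fe : B (sl2f F) (sl2e F) = 0 := by
    rw [← hBd, defect_apply, h, lie_f_e, map_neg, sub_self]
  have he : B (sl2h F) (sl2e F) = 0 := by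
    simpa [fe, lie_e_f, lie_self] using (hB (sl2e F) (sl2f F) (sl2e F)).symm
  have ee : B (sl2e F) (sl2e F) = 0 := by
    simpa [he, lie_e_h, lie_self, h2] using (hB (sl2e F) (sl2h F) (sl2e F)).symm
  have fh : B (sl2f F) (sl2h F) = 0 := by
    simpa [fe, lie_f_e, lie_self, h2] using (hB (sl2f F) (sl2f F) (sl2e F)).symm
  have ff : B (sl2f F) (sl2f F) = 0 := by
    simpa [fh, lie_f_h, lie_self, h2] using (hB (sl2f F) (sl2f F) (sl2h F)).symm
  have eh : B (sl2e F) (sl2h F) = 0 := by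
    simpa [ee, lie_f_e, he] using (hB (sl2f F) (sl2e F) (sl2e F)).symm
  have hh : B (sl2h F) (sl2h F) = 0 := by
    simpa [fe, lie_e_f, lie_e_h, fh] using (hB (sl2e F) (sl2f F) (sl2h F)).symm
  have ef : B (sl2e F) (sl2f F) = 0 := by
    simpa [eh, lie_f_e, lie_f_h, hh, h2] using (hB (sl2f F) (sl2e F) (sl2h F)).symm
  have hf : B (sl2h F) (sl2f F) = 0 := by
    simpa [ff, lie_e_f, fh] using (hB (sl2e F) (sl2f F) (sl2f F)).symm
  apply sl2_hom_ext <;> apply sl2_hom_ext <;>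
    simp only [fe, he, ee, fh, ff, eh, hh, ef, hf, LinearMap.zero_apply]

/-- The vector `f ⊗ f` generates the five-dimensional summand of `sl2 ⊗ sl2`; applying `ad e` twice
gives its weight-zero vector. -/
theorem lie_hh_of_ff (hα : Good ι α α) (hβ : Good ι β β)
    (h : ⁅α (sl2f F), β (sl2f F)⁆ = 0) :
    ⁅α (sl2h F), β (sl2h F)⁆ = ⁅α (sl2e F), β (sl2f F)⁆ + ⁅α (sl2f F), β (sl2e F)⁆ := by
  have h1 := lie_hf_of_ff hα hβ h
  have h2 := lie_lie_of_equivariant hα hβ (sl2e F) (sl2h F) (sl2f F)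
  have h3 := lie_lie_of_equivariant hα hβ (sl2e F) (sl2f F) (sl2h F)
  rw [h1, lie_neg, h3] at h2
  simp only [lie_e_h, lie_e_f, map_neg, map_smul, neg_lie, lie_neg, smul_lie, lie_smul] at h2
  linear_combination (norm := module) (-2⁻¹ : F) • h2

/-- Applying `ad e` to the `f`, `h` bracket produces the `f`, `e` bracket, to which `good_of_fe`
applies. -/
theorem good_of_ff (hα : Good ι α α) (hβ : Good ι β β) (hγ : Good ι γ γ)
    (hfh : ⁅α (sl2f F), β (sl2h F)⁆ = (2 : F) • γ (sl2f F))
    (hhh : ⁅α (sl2h F), β (sl2h F)⁆ = 0) : Good α β γ := by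
  apply good_of_fe hα hβ hγ
  have h1 := lie_lie_of_equivariant hα hβ (sl2e F) (sl2f F) (sl2h F)
  rw [hfh, lie_smul, hγ, lie_e_f, hhh, lie_e_h, map_neg, map_smul, lie_neg, lie_smul] at h1
  linear_combination (norm := module) (2⁻¹ : F) • h1

/-- The Casimir element `e f + f e + h h / 2` acts on the adjoint module by 4, which the factor
`4⁻¹` cancels. -/
theorem casimir_apply_of_good (hβ : Good ι β β) (h : Good α β γ) (s : sl2 F) :
    casimir ι α (β s) = γ s := by
  suffices H : casimir ι α ∘ₗ β = γ from LinearMap.congr_fun H s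
  apply sl2_hom_ext <;> rw [LinearMap.comp_apply, casimir_apply] <;>
    simp only [hβ _ _, h _ _, lie_h_e, lie_h_f, lie_e_f, lie_e_h, lie_f_h, lie_f_e, lie_self,
      map_neg, map_smul, map_zero, lie_neg, lie_smul, lie_zero] <;> module

theorem casimir_f (hα : Good ι α α) (hβ : Good ι β β) (h : ⁅α (sl2f F), β (sl2f F)⁆ = 0) :
    ⁅α (sl2f F), β (sl2h F)⁆ = (2 : F) • casimir ι α (β (sl2f F)) := by
  rw [casimir_apply, hβ, hβ, hβ, lie_self, lie_e_f, lie_h_f, map_neg, map_smul, map_zero, lie_neg,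
    lie_smul, lie_hf_of_ff hα hβ h, lie_zero]
  module

/-- The split Casimir tensor is `sl2`-invariant, so only the action on `v` survives. -/
theorem casimir_lie (hι : Good ι ι ι) (hα : Good ι α α) (s : sl2 F) (v : L) :
    casimir ι α ⁅ι s, v⁆ = ⁅ι s, casimir ι α v⁆ := by
  have key : ∀ c a b, ⁅ι c, ⁅α a, ⁅ι b, v⁆⁆⁆ =
      ⁅α ⁅c, a⁆, ⁅ι b, v⁆⁆ + ⁅α a, ⁅ι ⁅c, b⁆, v⁆⁆ + ⁅α a, ⁅ι b, ⁅ι c, v⁆⁆⁆ := by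
    intro c a b
    rw [leibniz_lie, hα, leibniz_lie (ι c) (ι b), hι, lie_add, add_assoc]
  have he : casimir ι α ⁅ι (sl2e F), v⁆ = ⁅ι (sl2e F), casimir ι α v⁆ := by
    simp only [casimir_apply, lie_smul, lie_add, key, lie_e_f, lie_e_h, lie_self, map_neg,
      map_smul, map_zero, neg_lie, lie_neg, smul_lie, zero_lie, lie_zero]
    module
  have hf : casimir ι α ⁅ι (sl2f F), v⁆ = ⁅ι (sl2f F), casimir ι α v⁆ := by
    simp only [casimir_apply, lie_smul, lie_add, key, lie_f_h, lie_f_e, lie_self, map_neg,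
      map_smul, map_zero, neg_lie, lie_neg, smul_lie, zero_lie, lie_zero]
    module
  have hh : casimir ι α ⁅ι (sl2h F), v⁆ = ⁅ι (sl2h F), casimir ι α v⁆ := by
    simp only [casimir_apply, lie_smul, lie_add, key, lie_h_e, lie_h_f, lie_self, map_neg,
      map_smul, map_zero, neg_lie, lie_neg, smul_lie, zero_lie, lie_zero]
    module
  rw [sl2_eq s]
  simp only [map_add, map_smul, add_lie, smul_lie, he, hf, hh]

theorem Good.casimir_comp (hι : Good ι ι ι) (hα : Good ι α α) (hβ : Good ι β β) :
    Good ι (casimir ι α ∘ₗ β) (casimir ι α ∘ₗ β) := fun a b => by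
  rw [LinearMap.comp_apply, ← casimir_lie hι hα, hβ, LinearMap.comp_apply]

end Equivariant

/-! ### Multiplicativity of the powers of one equivariant map. -/

section Powers

variable {F : Type*} [Field F] {L : Type*} [LieRing L] [LieAlgebra F L]
  {ι α : sl2 F →ₗ[F] L}

/-- The powers of an equivariant map. -/
def power (ι α : sl2 F →ₗ[F] L) : ℕ → sl2 F →ₗ[F] L
  | 0 => ι
  | n + 1 => casimir ι α ∘ₗ power ι α n

theorem jacobi_good {P : ℕ → sl2 F →ₗ[F] L} {N : ℕ}
    (ih : ∀ i j, i + j < N → Good (P i) (P j) (P (i + j))) {i j k : ℕ} (hi : 1 ≤ i) (hj : 1 ≤ j)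
    (hk : 1 ≤ k) (hN : i + j + k = N) (a b c : sl2 F) :
    ⁅P i a, P (j + k) ⁅b, c⁆⁆ + ⁅P j b, P (k + i) ⁅c, a⁆⁆ + ⁅P k c, P (i + j) ⁅a, b⁆⁆ = 0 := by
  rw [← ih j k (by omega), ← ih k i (by omega), ← ih i j (by omega)]
  exact lie_jacobi _ _ _

variable [CharZero F]

theorem power_one (hι : Good ι ι ι) (hα : Good ι α α) : power ι α 1 = α :=
  LinearMap.ext fun s => casimir_apply_of_good hι hα.symm s

theorem power_equivariant (hι : Good ι ι ι) (hα : Good ι α α) :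
    ∀ n, Good ι (power ι α n) (power ι α n)
  | 0 => hι
  | n + 1 => Good.casimir_comp hι hα (power_equivariant hι hα n)

/-- Jacobi on `f, f, h` makes all these brackets of degree `N` comparable. From degree 4 on, the
bracket of indices 1 and `N - 1` equals both the bracket of indices 2 and `N - 2` and its negative.
Degree 3 has no such room and must be assumed. -/
theorem lie_ff_eq_zero {P : ℕ → sl2 F →ₗ[F] L} {N : ℕ}
    (ih : ∀ i j, i + j < N → Good (P i) (P j) (P (i + j)))
    (h3 : ⁅P 1 (sl2f F), P 2 (sl2f F)⁆ = 0) {i j : ℕ} (hi : 1 ≤ i) (hj : 1 ≤ j)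
    (hN : i + j = N) : ⁅P i (sl2f F), P j (sl2f F)⁆ = 0 := by
  have swap : ∀ i j, ⁅P i (sl2f F), P j (sl2f F)⁆ = -⁅P j (sl2f F), P i (sl2f F)⁆ :=
    fun i j => (lie_skew _ _).symm
  have step : ∀ i j k, 1 ≤ i → 1 ≤ j → 1 ≤ k → i + j + k = N →
      ⁅P i (sl2f F), P (j + k) (sl2f F)⁆ = ⁅P j (sl2f F), P (k + i) (sl2f F)⁆ := by
    intro i j k hi hj hk hN
    have := jacobi_good ih hi hj hk hN (sl2f F) (sl2f F) (sl2h F)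
    rw [lie_self, map_zero, lie_zero, lie_f_h, lie_h_f, map_neg, map_smul, map_smul, lie_neg,
      lie_smul, lie_smul] at this
    linear_combination (norm := module) (2⁻¹ : F) • this
  obtain hN2 | hN3 | hN4 : N = 2 ∨ N = 3 ∨ 4 ≤ N := by omega
  · obtain ⟨rfl, rfl⟩ : i = 1 ∧ j = 1 := by omega
    exact lie_self _
  · obtain ⟨rfl, rfl⟩ | ⟨rfl, rfl⟩ : (i = 1 ∧ j = 2) ∨ (i = 2 ∧ j = 1) := by omega
    · exact h3
    · rw [swap, h3, neg_zero]
  · obtain ⟨m, rfl⟩ : ∃ m, N = m + 4 := ⟨N - 4, by omega⟩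
    have e1 := step 1 2 (m + 1) (by omega) (by omega) (by omega) (by omega)
    have e2 := step 1 (m + 2) 1 (by omega) (by omega) (by omega) (by omega)
    have e3 := swap (m + 2) (1 + 1)
    rw [show 2 + (m + 1) = m + 3 by omega, show m + 1 + 1 = m + 2 by omega] at e1
    rw [show m + 2 + 1 = m + 3 by omega] at e2
    have e0 : ⁅P 1 (sl2f F), P (m + 3) (sl2f F)⁆ = 0 := by
      linear_combination (norm := module) (2⁻¹ : F) • (e1 + e2 + e3)
    by_cases hj1 : j = 1
    · obtain rfl : i = m + 3 := by omega
      rw [swap, hj1, e0, neg_zero]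
    · have := step i 1 (j - 1) hi le_rfl (by omega) (by omega)
      rw [show 1 + (j - 1) = j by omega, show j - 1 + i = m + 3 by omega, e0] at this
      exact this

/-- A cyclic identity forces the bracket to depend linearly on the first index; antisymmetry then
gives `N` times the bracket of indices 1 and `N - 1` equal to zero, and characteristic 0 concludes.
-/
theorem lie_hh_eq_zero {P : ℕ → sl2 F →ₗ[F] L} {N : ℕ} (hP : ∀ n, Good ι (P n) (P n))
    (ih : ∀ i j, i + j < N → Good (P i) (P j) (P (i + j)))
    (hff : ∀ i j, 1 ≤ i → 1 ≤ j → i + j = N → ⁅P i (sl2f F), P j (sl2f F)⁆ = 0) {i j : ℕ}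
    (hi : 1 ≤ i) (hj : 1 ≤ j) (hN : i + j = N) : ⁅P i (sl2h F), P j (sl2h F)⁆ = 0 := by
  have swap : ∀ i j, ⁅P i (sl2h F), P j (sl2h F)⁆ = -⁅P j (sl2h F), P i (sl2h F)⁆ :=
    fun i j => (lie_skew _ _).symm
  have step : ∀ i j k, 1 ≤ i → 1 ≤ j → 1 ≤ k → i + j + k = N →
      ⁅P i (sl2h F), P (j + k) (sl2h F)⁆ + ⁅P j (sl2h F), P (k + i) (sl2h F)⁆ +
        ⁅P k (sl2h F), P (i + j) (sl2h F)⁆ = 0 := by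
    intro i j k hi hj hk hN
    have h1 := jacobi_good ih hi hj hk hN (sl2e F) (sl2f F) (sl2h F)
    have h2 := jacobi_good ih hi hj hk hN (sl2f F) (sl2e F) (sl2h F)
    rw [lie_f_h, lie_h_e, lie_e_f, map_smul, map_smul, lie_smul, lie_smul] at h1
    rw [lie_e_h, lie_h_f, lie_f_e, map_neg, map_neg, map_neg, map_smul, map_smul, lie_neg, lie_neg,
      lie_neg, lie_smul, lie_smul] at h2
    have h3 := lie_hh_of_ff (hP i) (hP (j + k)) (hff _ _ hi (by omega) (by omega))
    have h4 := lie_hh_of_ff (hP j) (hP (k + i)) (hff _ _ hj (by omega) (by omega))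
    linear_combination (norm := module) h3 + h4 + (2⁻¹ : F) • (h1 - h2)
  have lin : ∀ m n, 1 ≤ n → m + 1 + n = N →
      ⁅P (m + 1) (sl2h F), P n (sl2h F)⁆ =
        ((m + 1 : ℕ) : F) • ⁅P 1 (sl2h F), P (N - 1) (sl2h F)⁆ := by
    intro m
    induction m with
    | zero =>
      intro n _ hn
      rw [show n = N - 1 by omega, zero_add, Nat.cast_one, one_smul]
    | succ m ihm =>
      intro n hn hn'
      have e1 := step 1 (m + 1) n le_rfl (by omega) hn (by omega)
      rw [show m + 1 + n = N - 1 by omega, ihm (n + 1) (by omega) (by omega),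
        show 1 + (m + 1) = m + 1 + 1 by omega, swap n] at e1
      push_cast at e1 ⊢
      linear_combination (norm := module) -e1
  have h1 : ⁅P 1 (sl2h F), P (N - 1) (sl2h F)⁆ = 0 := by
    have e1 := lin (N - 2) 1 le_rfl (by omega)
    rw [show N - 2 + 1 = N - 1 by omega, swap] at e1
    have e2 : (((N - 1 : ℕ) : F) + 1) • ⁅P 1 (sl2h F), P (N - 1) (sl2h F)⁆ = 0 := by
      rw [add_smul, ← e1, one_smul, neg_add_cancel]
    exact (smul_eq_zero.1 e2).resolve_left (Nat.cast_add_one_ne_zero _)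
  have := lin (i - 1) j hj (by omega)
  rwa [h1, smul_zero, show i - 1 + 1 = i by omega] at this

theorem power_good (hι : Good ι ι ι) (hα : Good ι α α)
    (h3 : ⁅power ι α 1 (sl2f F), power ι α 2 (sl2f F)⁆ = 0) (i j : ℕ) :
    Good (power ι α i) (power ι α j) (power ι α (i + j)) := by
  have hP := power_equivariant hι hα
  suffices H : ∀ N i j, i + j < N → Good (power ι α i) (power ι α j) (power ι α (i + j)) from
    H (i + j + 1) i j (Nat.lt_succ_self _)
  intro N
  induction N with
  | zero => intro i j h; omega
  | succ N ih =>
    intro i j hij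
    by_cases hlt : i + j < N
    · exact ih i j hlt
    have hN : i + j = N := by omega
    rcases Nat.eq_zero_or_pos i with rfl | hi
    · rw [zero_add]; exact hP j
    rcases Nat.eq_zero_or_pos j with rfl | hj
    · exact (hP i).symm
    have hff := fun i j hi hj hN => lie_ff_eq_zero (P := power ι α) ih h3 (i := i) (j := j) hi hj hN
    have hhh := lie_hh_eq_zero hP ih hff hi hj hN
    -- The definition of the next power fixes the bracket with index 1; Jacobi on `f, e, f` moves
    -- the other index pairs to this one.
    have h1 : ⁅power ι α 1 (sl2f F), power ι α (N - 1) (sl2h F)⁆ =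
        (2 : F) • power ι α N (sl2f F) := by
      have := casimir_f (hP 1) (hP (N - 1)) (hff 1 (N - 1) le_rfl (by omega) (by omega))
      rw [this, power_one hι hα]
      conv_rhs => rw [show N = N - 1 + 1 by omega]
      rfl
    apply good_of_ff (hP i) (hP j) (hP _) _ hhh
    by_cases hj1 : j = 1
    · subst hj1
      have := lie_hf_of_ff (hP 1) (hP (N - 1)) (hff 1 (N - 1) le_rfl (by omega) (by omega))
      rw [← lie_skew, show i = N - 1 by omega, this, neg_neg, h1, show N - 1 + 1 = N by omega]
    · have := jacobi_good ih hi (j := j - 1) (by omega) le_rfl (by omega) (sl2f F) (sl2e F) (sl2f F)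
      rw [lie_self, map_zero, lie_zero, add_zero, lie_e_f, lie_f_e, map_neg, lie_neg,
        show j - 1 + 1 = j by omega, show i + (j - 1) = N - 1 by omega, h1] at this
      rw [hN]
      linear_combination (norm := module) this

end Powers

/-! ### Extracting powers and products from the defining relations. -/

section Seed

theorem eqy_add_eqz {F : Type*} [Field F] : eqy F + eqz F = -((2 : F) • sl2f F) := by
  rw [eqy, eqz, sub_add_cancel]

theorem eqz_add_eqx {F : Type*} [Field F] : eqz F + eqx F = (2 : F) • sl2e F := by
  rw [eqx, eqz, add_sub_cancel]

variable {F : Type*} [Field F] {L : Type*} [LieRing L] [LieAlgebra F L] {ι : sl2 F →ₗ[F] L}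

/-- The powers of an equivariant map. -/
def IsPowers (ι : sl2 F →ₗ[F] L) (P : ℕ → sl2 F →ₗ[F] L) : Prop :=
  P 0 = ι ∧ ∀ i j, Good (P i) (P j) (P (i + j))

theorem IsPowers.equivariant {P : ℕ → sl2 F →ₗ[F] L} (hP : IsPowers ι P) (n : ℕ) : Good ι (P n) (P n) := by
  have := hP.2 0 n
  rwa [hP.1, zero_add] at this

variable [CharZero F]

/-- A lowest weight vector of weight `-2` killed by `(ad e)^3` generates an adjoint module. -/
theorem exists_equivariant (hι : Good ι ι ι) {u : L} (hu : ⁅ι (sl2h F), u⁆ = -((2 : F) • u))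
    (fu : ⁅ι (sl2f F), u⁆ = 0) (eu : ⁅ι (sl2e F), ⁅ι (sl2e F), ⁅ι (sl2e F), u⁆⁆⁆ = 0) :
    ∃ α : sl2 F →ₗ[F] L, Good ι α α ∧ α (sl2f F) = u := by
  have hh1 : ⁅ι (sl2h F), ⁅ι (sl2e F), u⁆⁆ = 0 := by
    rw [leibniz_lie, hι, lie_h_e, hu, map_smul, smul_lie, lie_neg, lie_smul, add_neg_cancel]
  have hh2 : ⁅ι (sl2h F), ⁅ι (sl2e F), ⁅ι (sl2e F), u⁆⁆⁆ =
      (2 : F) • ⁅ι (sl2e F), ⁅ι (sl2e F), u⁆⁆ := by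
    rw [leibniz_lie, hι, lie_h_e, hh1, map_smul, smul_lie, lie_zero, add_zero]
  have hf1 : ⁅ι (sl2f F), ⁅ι (sl2e F), u⁆⁆ = (2 : F) • u := by
    rw [leibniz_lie, hι, lie_f_e, fu, map_neg, neg_lie, hu, lie_zero, add_zero, neg_neg]
  have hf2 : ⁅ι (sl2f F), ⁅ι (sl2e F), ⁅ι (sl2e F), u⁆⁆⁆ = (2 : F) • ⁅ι (sl2e F), u⁆ := by
    rw [leibniz_lie, hι, lie_f_e, hf1, map_neg, neg_lie, hh1, lie_smul, neg_zero, zero_add]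
  refine ⟨sl2Lift (-((2⁻¹ : F) • ⁅ι (sl2e F), ⁅ι (sl2e F), u⁆⁆)) u ⁅ι (sl2e F), u⁆,
    ?_, sl2Lift_f _ _ _⟩
  apply good_of_basis <;>
    simp only [sl2Lift_e, sl2Lift_f, sl2Lift_h, lie_neg, lie_smul, eu, fu, hu, hh1, hh2, hf1, hf2,
      smul_zero, neg_zero] <;> module

theorem exists_powers (hι : Good ι ι ι) {p : L}
    (hy : ⁅ι (eqy F), p⁆ = (2 : F) • p - (2 : F) • ι (eqy F))
    (hz : ⁅ι (eqz F), p⁆ = -((2 : F) • p) - (2 : F) • ι (eqz F))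
    (hxp : ⁅ι (eqx F), ⁅ι (eqx F), ⁅ι (eqx F), p⁆⁆⁆ = (4 : F) • ⁅ι (eqx F), p⁆)
    (hpx : ⁅p, ⁅p, ⁅p, ι (eqx F)⁆⁆⁆ = (4 : F) • ⁅p, ι (eqx F)⁆) :
    ∃ P : ℕ → sl2 F →ₗ[F] L, IsPowers ι P ∧ p = P 1 (eqy F + eqz F) - ι (eqz F) := by
  -- In the loop algebra `x_03` is `-2 t ⊗ f - 1 ⊗ h`, so `u` stands for `t ⊗ f`.
  obtain ⟨u, rfl⟩ : ∃ u, p = -((2 : F) • u) - ι (sl2h F) :=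
    ⟨-((2⁻¹ : F) • (p + ι (sl2h F))), by module⟩
  have ihe : ⁅ι (sl2h F), ι (sl2e F)⁆ = (2 : F) • ι (sl2e F) := by rw [hι, lie_h_e, map_smul]
  have ieh : ⁅ι (sl2e F), ι (sl2h F)⁆ = -((2 : F) • ι (sl2e F)) := by
    rw [hι, lie_e_h, map_neg, map_smul]
  have ifh : ⁅ι (sl2f F), ι (sl2h F)⁆ = (2 : F) • ι (sl2f F) := by rw [hι, lie_f_h, map_smul]
  have hu : ⁅ι (sl2h F), u⁆ = -((2 : F) • u) := by
    simp only [eqz, lie_sub, lie_neg, lie_smul, lie_self] at hz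
    linear_combination (norm := module) (-2⁻¹ : F) • hz
  have uh : ⁅u, ι (sl2h F)⁆ = (2 : F) • u := by rw [← lie_skew, hu, neg_neg]
  have fu : ⁅ι (sl2f F), u⁆ = 0 := by
    simp only [eqy, map_sub, map_neg, map_smul, sub_lie, neg_lie, smul_lie, lie_sub, lie_neg,
      lie_smul, lie_self, hu, ifh] at hy
    linear_combination (norm := module) (4⁻¹ : F) • hy
  have hu1 : ⁅ι (sl2h F), ⁅ι (sl2e F), u⁆⁆ = 0 := by
    rw [leibniz_lie, ihe, hu, smul_lie, lie_neg, lie_smul, add_neg_cancel]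
  have hu2 : ⁅ι (sl2h F), ⁅ι (sl2e F), ⁅ι (sl2e F), u⁆⁆⁆ =
      (2 : F) • ⁅ι (sl2e F), ⁅ι (sl2e F), u⁆⁆ := by
    rw [leibniz_lie, ihe, hu1, smul_lie, lie_zero, add_zero]
  -- The Dolan-Grady relation cubic in `x` reduces to nilpotency of `ad e` on `u`, since the weights
  -- of the lower terms are known.
  have eu : ⁅ι (sl2e F), ⁅ι (sl2e F), ⁅ι (sl2e F), u⁆⁆⁆ = 0 := by
    simp only [eqx, map_sub, map_smul, sub_lie, smul_lie, lie_sub, lie_neg, lie_smul,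
      lie_self, hu, hu1, hu2, ihe, ieh, lie_zero] at hxp
    linear_combination (norm := module) (-16⁻¹ : F) • hxp
  obtain ⟨α, hα, rfl⟩ := exists_equivariant hι hu fu eu
  have hv : ⁅ι (sl2h F), ⁅α (sl2f F), ι (sl2e F)⁆⁆ = 0 := by
    rw [leibniz_lie, ihe, hu, neg_lie, smul_lie, lie_smul, neg_add_cancel]
  have hw : ⁅ι (sl2h F), ⁅α (sl2f F), ⁅α (sl2f F), ι (sl2e F)⁆⁆⁆ =
      -((2 : F) • ⁅α (sl2f F), ⁅α (sl2f F), ι (sl2e F)⁆⁆) := by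
    rw [leibniz_lie, hu, hv, neg_lie, smul_lie, lie_zero, add_zero]
  -- The opposite Dolan-Grady relation gives the degree-3 input of `power_good`: the double bracket
  -- of `u` with `e` is `-2 t^2 ⊗ f`.
  have ue : ⁅α (sl2f F), ⁅α (sl2f F), ⁅α (sl2f F), ι (sl2e F)⁆⁆⁆ = 0 := by
    simp only [eqx, map_sub, map_smul, sub_lie, neg_lie, smul_lie, lie_sub, lie_neg, lie_smul,
      lie_self, hu, uh, hv, hw, ihe, lie_zero] at hpx
    linear_combination (norm := module) (-16⁻¹ : F) • hpx
  refine ⟨power ι α, ⟨rfl, power_good hι hα ?_⟩, ?_⟩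
  · have h1 := casimir_f hα hα (lie_self _)
    have h2 : ⁅ι (sl2e F), α (sl2f F)⁆ = α (sl2h F) := by rw [hα, lie_e_f]
    have h3 : casimir ι α (α (sl2f F)) =
        (-2⁻¹ : F) • ⁅α (sl2f F), ⁅α (sl2f F), ι (sl2e F)⁆⁆ := by
      rw [← lie_skew _ (ι (sl2e F)), h2, lie_neg, h1]
      module
    change ⁅_, casimir ι α (power ι α 1 (sl2f F))⁆ = 0
    rw [power_one hι hα, h3, lie_smul, ue, smul_zero]
  · rw [power_one hι hα, eqy_add_eqz, map_neg, map_smul, eqz]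

/-- After expansion in `e`, `f`, `h` the triangle relation is exactly the value at `f ⊗ e` of the
product rule `t t' = t - 1`, enough by `good_of_fe`. -/
theorem good_of_triangle {α β : sl2 F →ₗ[F] L} (hι : Good ι ι ι) (hα : Good ι α α)
    (hβ : Good ι β β) {p q : L} (hp : p = α (eqy F + eqz F) - ι (eqz F))
    (hq : q = β (eqz F + eqx F) - ι (eqx F)) (h : ⁅p, q⁆ = (2 : F) • p - (2 : F) • q) :
    Good α β (α - ι) := by
  apply good_of_fe hα hβ (hα.sub_right hι)
  have h1 : ⁅α (sl2f F), ι (sl2e F)⁆ = -α (sl2h F) := by rw [← lie_skew, hα, lie_e_f]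
  have h2 : ⁅α (sl2f F), ι (sl2h F)⁆ = (2 : F) • α (sl2f F) := by
    rw [← lie_skew, hα, lie_h_f, map_neg, neg_neg, map_smul]
  have h3 : ⁅ι (sl2h F), β (sl2e F)⁆ = (2 : F) • β (sl2e F) := by rw [hβ, lie_h_e, map_smul]
  have h4 : ⁅ι (sl2h F), ι (sl2e F)⁆ = (2 : F) • ι (sl2e F) := by rw [hι, lie_h_e, map_smul]
  rw [hp, hq, eqy_add_eqz, eqz_add_eqx, eqx, eqz] at h
  simp only [map_sub, map_neg, map_smul, sub_lie, neg_lie, smul_lie, lie_sub, lie_smul, lie_self,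
    h1, h2, h3, h4] at h
  rw [LinearMap.sub_apply]
  linear_combination (norm := module) (-4⁻¹ : F) • h

end Seed

/-! ### The order-three symmetry of the equitable basis. -/

section Rotation

variable {F : Type*} [Field F]

/-- The automorphism of `sl2` permuting the equitable basis cyclically. -/
def rot (F : Type*) [Field F] : sl2 F →ₗ[F] sl2 F :=
  sl2Lift (sl2e F - sl2f F - sl2h F) (-sl2e F) ((2 : F) • sl2e F - sl2h F)

theorem rot_rot_rot (s : sl2 F) : rot F (rot F (rot F s)) = s := by
  suffices H : rot F ∘ₗ rot F ∘ₗ rot F = LinearMap.id from LinearMap.congr_fun H s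
  apply sl2_hom_ext <;>
    simp only [rot, LinearMap.comp_apply, LinearMap.id_apply, sl2Lift_e, sl2Lift_f, sl2Lift_h,
      map_sub, map_neg, map_smul] <;> module

theorem rot_lie (a b : sl2 F) : rot F ⁅a, b⁆ = ⁅rot F a, rot F b⁆ := by
  suffices H : Good (rot F) (rot F) (rot F) from (H a b).symm
  apply good_of_basis <;>
    simp only [rot, sl2Lift_e, sl2Lift_f, sl2Lift_h, sub_lie, lie_sub, neg_lie, lie_neg, smul_lie,
      lie_smul, lie_self, lie_h_e, lie_h_f, lie_e_f, lie_e_h, lie_f_h, lie_f_e] <;> module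

theorem rot_eqz : rot F (eqz F) = eqx F := by
  simp only [rot, eqx, eqz, sl2Lift_h]

theorem rot_eqx : rot F (eqx F) = eqy F := by
  simp only [rot, eqx, eqy, sl2Lift_h, sl2Lift_e, map_sub, map_smul]
  module

theorem rot_eqy : rot F (eqy F) = eqz F := by
  rw [← rot_eqx, ← rot_eqz, rot_rot_rot]

variable {L : Type*} [LieRing L] [LieAlgebra F L] {α β γ : sl2 F →ₗ[F] L}

theorem good_comp_rot : Good (α ∘ₗ rot F) (β ∘ₗ rot F) (γ ∘ₗ rot F) ↔ Good α β γ := by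
  constructor
  · intro h a b
    have := h (rot F (rot F a)) (rot F (rot F b))
    simpa only [LinearMap.comp_apply, rot_lie, rot_rot_rot] using this
  · intro h a b
    simp only [LinearMap.comp_apply, rot_lie, h _ _]

theorem exists_comp_rot (α : sl2 F →ₗ[F] L) : ∃ β, α = β ∘ₗ rot F :=
  ⟨α ∘ₗ rot F ∘ₗ rot F, by ext s; simp only [LinearMap.comp_apply, rot_rot_rot]⟩

theorem IsPowers.exists_comp_rot {ι : sl2 F →ₗ[F] L} {P : ℕ → sl2 F →ₗ[F] L}
    (hP : IsPowers (ι ∘ₗ rot F) P) :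
    ∃ Q, IsPowers ι Q ∧ ∀ n, P n = Q n ∘ₗ rot F := by
  choose Q hQ using fun n => TetAlg.exists_comp_rot (P n)
  refine ⟨Q, ⟨?_, fun i j => ?_⟩, hQ⟩
  · ext s
    have := LinearMap.congr_fun ((hQ 0).symm.trans hP.1) (rot F (rot F s))
    simpa only [LinearMap.comp_apply, rot_rot_rot] using this
  · rw [← good_comp_rot, ← hQ, ← hQ, ← hQ]
    exact hP.2 i j

end Rotation

/-! ### Products of powers from different families. -/

section Cross

variable {F : Type*} [Field F] [CharZero F] {L : Type*} [LieRing L] [LieAlgebra F L]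
  {ι : sl2 F →ₗ[F] L} {P Q : ℕ → sl2 F →ₗ[F] L}

/-- If `p b = p - 1` then `b p^(n+1) = p^(n+1) - p^n`, by induction through `Good.assoc`. -/
theorem IsPowers.cross_left {β : sl2 F →ₗ[F] L} (hP : IsPowers ι P)
    (h : Good (P 1) β (P 1 - ι)) (n : ℕ) :
    Good β (P (n + 1)) (P (n + 1) - P n) := by
  induction n with
  | zero => rw [zero_add, hP.1]; exact h.symm
  | succ n ih =>
    refine Good.assoc h.symm (γ := P (n + 1)) ?_ ih ?_ ?_
    · rw [add_comm (n + 1)]; exact hP.2 1 (n + 1)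
    · refine Good.sub_left ?_ (hP.equivariant _)
      rw [add_comm (n + 1)]; exact hP.2 1 (n + 1)
    · have := (hP.2 1 (n + 1)).sub_right (hP.2 1 n)
      rwa [add_comm 1, add_comm 1] at this

/-- The geometric sum: `p (1 - q) = 1` gives `p q^n = p - (1 + q + ... + q^(n-1))`. -/
theorem IsPowers.cross_right (hP : IsPowers ι P) (hQ : IsPowers ι Q)
    (h : Good (P 1) (Q 1) (P 1 - ι)) (n : ℕ) :
    Good (P 1) (Q n) (P 1 - ∑ k ∈ Finset.range n, Q k) := by
  -- The second conjunct, `q (p q^n) = p q^(n+1)`, is carried along because `Good.assoc` needs that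
  -- product to be known.
  suffices H : Good (P 1) (Q n) (P 1 - ∑ k ∈ Finset.range n, Q k) ∧
      Good (Q 1) (P 1 - ∑ k ∈ Finset.range n, Q k) (P 1 - ∑ k ∈ Finset.range (n + 1), Q k) from H.1
  induction n with
  | zero =>
    simp only [Finset.range_zero, Finset.sum_empty, sub_zero, zero_add, Finset.range_one,
      Finset.sum_singleton, hQ.1]
    exact ⟨(hP.equivariant 1).symm, h.symm⟩
  | succ n ih =>
    have e : ∀ n, P 1 - ∑ k ∈ Finset.range (n + 1), Q k =
        P 1 - ∑ k ∈ Finset.range n, Q k - Q n := fun n => by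
      rw [Finset.sum_range_succ, sub_add_eq_sub_sub]
    constructor
    · refine Good.assoc h (γ := Q n) ?_ ih.1 ?_ ih.2
      · rw [add_comm]; exact hQ.2 1 n
      · rw [e]
        exact ih.1.sub_left (hQ.equivariant n)
    · rw [e (n + 1)]
      conv in (occs := 1) P 1 - _ => rw [e]
      have := ih.2.sub_right (hQ.2 1 n)
      rwa [add_comm 1 n] at this

end Cross

/-! ### Casimir operators inside a commutative centroid. -/

section Centroid

variable {F : Type*} [Field F] {L : Type*} [LieRing L] [LieAlgebra F L]

/-- The centroid of a Lie algebra. -/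
def centroid (F : Type*) [Field F] (L : Type*) [LieRing L] [LieAlgebra F L] :
    Subalgebra F (Module.End F L) :=
  Subalgebra.centralizer F (Set.range (LieAlgebra.ad F L))

theorem mem_centroid {T : Module.End F L} : T ∈ centroid F L ↔ ∀ x v : L, ⁅x, T v⁆ = T ⁅x, v⁆ := by
  rw [centroid, Subalgebra.mem_centralizer_iff]
  simp only [Set.forall_mem_range]
  exact forall_congr' fun x => LinearMap.ext_iff

/-- The Lie subalgebra of all elements whose adjoint action commutes with `T`. -/
def commutingSubalgebra (T : Module.End F L) : LieSubalgebra F L where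
  carrier := {x | ∀ v, ⁅x, T v⁆ = T ⁅x, v⁆}
  add_mem' hx hy v := by rw [add_lie, hx v, hy v, add_lie, map_add]
  zero_mem' v := by rw [zero_lie, zero_lie, map_zero]
  smul_mem' r x hx v := by rw [smul_lie, hx v, smul_lie, map_smul]
  lie_mem' {x y} hx hy v := by
    simp only [Set.mem_ofPred_eq] at hx hy
    rw [lie_lie, hy, hx, hx, hy, lie_lie, map_sub]

/-- The Lie subalgebra of all elements whose adjoint action preserves `S`. -/
def stabilizerSubalgebra (S : Submodule F L) : LieSubalgebra F L where
  carrier := {x | ∀ v ∈ S, ⁅x, v⁆ ∈ S}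
  add_mem' hx hy v hv := by rw [add_lie]; exact S.add_mem (hx v hv) (hy v hv)
  zero_mem' v _ := by rw [zero_lie]; exact S.zero_mem
  smul_mem' r x hx v hv := by rw [smul_lie]; exact S.smul_mem r (hx v hv)
  lie_mem' {x y} hx hy v hv := by
    rw [lie_lie]
    exact S.sub_mem (hx _ (hy _ hv)) (hy _ (hx _ hv))

/-- A set `G` of linear maps from `sl2` whose images generate `L`, contained in a space `J` of
equivariant maps which is stable under multiplication by `G`. -/
structure IsClosedFamily (ι : sl2 F →ₗ[F] L) (G : Set (sl2 F →ₗ[F] L))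
    (J : Submodule F (sl2 F →ₗ[F] L)) : Prop where
  mem : ι ∈ G
  le : G ⊆ J
  equivariant : ∀ β ∈ J, Good ι β β
  closed : ∀ g ∈ G, ∀ β ∈ J, ∃ γ ∈ J, Good g β γ
  gen : ∀ K : LieSubalgebra F L, (∀ g ∈ G, ∀ s, g s ∈ K) → K = ⊤

variable {ι : sl2 F →ₗ[F] L} {G : Set (sl2 F →ₗ[F] L)} {J : Submodule F (sl2 F →ₗ[F] L)}

/-- The span is stable under the generators, hence under all of `L`; it is then a subalgebra
containing the generators. -/
theorem IsClosedFamily.span_eq_top (h : IsClosedFamily ι G J) :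
    Submodule.span F {v | ∃ β ∈ J, ∃ s, β s = v} = ⊤ := by
  set S := Submodule.span F {v | ∃ β ∈ J, ∃ s, β s = v} with hS
  have h1 : stabilizerSubalgebra S = ⊤ := by
    refine h.gen _ fun g hg s v hv => ?_
    induction hv using Submodule.span_induction with
    | mem v hv =>
      obtain ⟨β, hβ, b, rfl⟩ := hv
      obtain ⟨γ, hγ, hgood⟩ := h.closed g hg β hβ
      rw [hgood]
      exact Submodule.subset_span ⟨γ, hγ, _, rfl⟩
    | zero => rw [lie_zero]; exact S.zero_mem
    | add x y _ _ hx hy => rw [lie_add]; exact S.add_mem hx hy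
    | smul r x _ hx => rw [lie_smul]; exact S.smul_mem r hx
  have hx : ∀ x, x ∈ stabilizerSubalgebra S := fun x => h1 ▸ LieSubalgebra.mem_top x
  let K : LieSubalgebra F L := { S with lie_mem' := fun {x y} _ hy => hx x y hy }
  have hK : K = ⊤ := h.gen K fun g hg s => Submodule.subset_span ⟨g, h.le hg, s, rfl⟩
  rw [eq_top_iff]
  intro v _
  have : v ∈ K := hK ▸ LieSubalgebra.mem_top v
  exact this

variable [CharZero F]

/-- Commuting with the operator need only be tested for generators acting on values of members of
`J`, where it is `Good.comm`. -/
theorem IsClosedFamily.casimir_mem (h : IsClosedFamily ι G J) {g : sl2 F →ₗ[F] L} (hg : g ∈ G) :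
    casimir ι g ∈ centroid F L := by
  have h1 : commutingSubalgebra (casimir ι g) = ⊤ := by
    refine h.gen _ fun g' hg' s v => ?_
    have hv : v ∈ Submodule.span F {v | ∃ β ∈ J, ∃ s, β s = v} :=
      h.span_eq_top ▸ Submodule.mem_top
    induction hv using Submodule.span_induction with
    | mem v hv =>
      obtain ⟨β, hβ, b, rfl⟩ := hv
      obtain ⟨r, hr, hgr⟩ := h.closed g hg β hβ
      obtain ⟨s', hs, hgs⟩ := h.closed g' hg' r hr
      obtain ⟨p, hp, hgp⟩ := h.closed g' hg' β hβ
      obtain ⟨q, hq, hgq⟩ := h.closed g hg p hp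
      obtain ⟨w, _, hw⟩ := h.closed g' hg' g (h.le hg)
      rw [casimir_apply_of_good (h.equivariant β hβ) hgr, hgs, hgp,
        casimir_apply_of_good (h.equivariant p hp) hgq,
        Good.comm hgr hgs hgp hgq ⟨w, hw⟩ (h.equivariant _ hs) (h.equivariant _ hq)]
    | zero => simp only [map_zero, lie_zero]
    | add x y _ _ hx hy => simp only [map_add, lie_add, hx, hy]
    | smul r x _ hx => simp only [map_smul, lie_smul, hx]
  exact mem_centroid.2 fun x => (h1 ▸ LieSubalgebra.mem_top x : x ∈ commutingSubalgebra _)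

/-- The kernel of a centroid element is an ideal; once it contains the image of `ι` it contains `g
⁅a, b⁆ = ⁅ι a, g b⁆` for every generator `g`. -/
theorem IsClosedFamily.eq_of_mem_centroid (h : IsClosedFamily ι G J) {T U : Module.End F L}
    (hT : T ∈ centroid F L) (hU : U ∈ centroid F L) (hTU : ∀ s, T (ι s) = U (ι s)) : T = U := by
  rw [← sub_eq_zero]
  have hV := mem_centroid.1 (Subalgebra.sub_mem _ hT hU)
  have hι : ∀ s, (T - U) (ι s) = 0 := fun s => by rw [LinearMap.sub_apply, hTU, sub_self]
  generalize T - U = V at hV hι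
  let K : LieSubalgebra F L :=
    { LinearMap.ker V with
      lie_mem' := fun {x y} _ hy => by
        change V ⁅x, y⁆ = 0
        rw [← hV, (hy : V y = 0), lie_zero] }
  have hK : K = ⊤ := by
    refine h.gen K fun g hg s => sl2_mem_of_lie (S := K.toSubmodule) (fun a b => ?_) s
    change V (g ⁅a, b⁆) = 0
    rw [← h.equivariant g (h.le hg), ← lie_skew, map_neg, ← hV, hι, lie_zero, neg_zero]
  ext v
  exact (hK ▸ LieSubalgebra.mem_top v : v ∈ K)

/-- On a bracket, one operator can be moved into each slot, so their order is immaterial; brackets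
span the image of `ι`. -/
theorem IsClosedFamily.centroid_comm (h : IsClosedFamily ι G J) {T U : Module.End F L}
    (hT : T ∈ centroid F L) (hU : U ∈ centroid F L) : T * U = U * T := by
  refine h.eq_of_mem_centroid (Subalgebra.mul_mem _ hT hU) (Subalgebra.mul_mem _ hU hT) fun s => ?_
  rw [← sub_eq_zero]
  have hT' := mem_centroid.1 hT
  have hU' := mem_centroid.1 hU
  have hι : Good ι ι ι := h.equivariant ι (h.le h.mem)
  refine sl2_mem_of_lie (S := LinearMap.ker (T * U - U * T)) (fun a b => ?_) s
  rw [← hι, LinearMap.mem_ker, LinearMap.sub_apply, Module.End.mul_apply, Module.End.mul_apply,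
    ← hU', ← lie_skew, map_neg, ← hT', lie_skew, ← lie_skew (ι a), map_neg, ← hT', lie_skew, ← hU',
    sub_self]

end Centroid

/-! ### The ring `A F` and maps out of the loop algebra. -/

section Localization

variable {F : Type*} [Field F]

theorem algebraMap_eq_aeval (p : Polynomial F) :
    algebraMap (Polynomial F) (A F) p = Polynomial.aeval (t F) p := by
  rw [t, Polynomial.aeval_algebraMap_apply, Polynomial.aeval_X_left_apply]

theorem subalgebra_eq_top {B : Subalgebra F (A F)} (h : t F ∈ B) (h' : t' F ∈ B)
    (h'' : t'' F ∈ B) : B = ⊤ := by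
  have hi : tInv F ∈ B := by
    have := B.sub_mem B.one_mem h'
    rwa [t', sub_sub_cancel] at this
  have hd : invD F ∈ B := by
    have := B.neg_mem (B.mul_mem hi h'')
    rwa [tInv, t'', oneSubTInv, show -((t F - 1) * invD F * -(t F * invD F)) =
      t F * (t F - 1) * invD F * invD F by ring, t_mul_invD, one_mul] at this
  rw [eq_top_iff]
  intro a _
  obtain ⟨n, p, hp⟩ := IsLocalization.Away.surj
    (Polynomial.X * (Polynomial.X - 1) : Polynomial F) a
  have hX : algebraMap (Polynomial F) (A F) (Polynomial.X * (Polynomial.X - 1)) * invD F = 1 := by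
    rw [map_mul, map_sub, map_one]
    exact t_mul_invD F
  have ha : a = algebraMap (Polynomial F) (A F) p * invD F ^ n := by
    rw [← hp, mul_assoc, ← mul_pow, hX, one_pow, mul_one]
  rw [ha, algebraMap_eq_aeval]
  exact B.mul_mem (Polynomial.aeval_mem_adjoin_singleton F _ |>
    (Algebra.adjoin_le (Set.singleton_subset_iff.2 h) ·)) (B.pow_mem hd n)

/-- The universal property of `A`. -/
theorem exists_algHom {C : Type*} [CommRing C] [Algebra F C] {a b c : C} (hab : a * (1 - b) = 1)
    (hac : (1 - a) * c = 1) : ∃ φ : A F →ₐ[F] C, φ (t F) = a ∧ φ (t' F) = b ∧ φ (t'' F) = c := by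
  have hu : IsUnit ((Polynomial.aeval a : Polynomial F →ₐ[F] C)
      (Polynomial.X * (Polynomial.X - 1))) := by
    rw [map_mul, map_sub, map_one, Polynomial.aeval_X]
    exact IsUnit.of_mul_eq_one (-((1 - b) * c)) (by linear_combination (1 - a) * c * hab + hac)
  let φ₀ : A F →+* C := IsLocalization.Away.lift (Polynomial.X * (Polynomial.X - 1) : Polynomial F)
    (g := ((Polynomial.aeval a : Polynomial F →ₐ[F] C) : Polynomial F →+* C)) hu
  have hφ : ∀ p, φ₀ (algebraMap (Polynomial F) (A F) p) = Polynomial.aeval a p :=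
    fun p => IsLocalization.Away.lift_eq _ hu p
  let φ : A F →ₐ[F] C := { φ₀ with
    commutes' := fun r => by
      rw [IsScalarTower.algebraMap_apply F (Polynomial F) (A F)]
      exact (hφ _).trans (AlgHom.commutes _ r) }
  have h1 : φ (t F) = a := (hφ _).trans (Polynomial.aeval_X a)
  refine ⟨φ, h1, ?_, ?_⟩
  · have h2 : a * φ (tInv F) = 1 := by rw [← h1, ← map_mul, t_mul_tInv, map_one]
    rw [t', map_sub, map_one]
    linear_combination φ (tInv F) * hab - (1 - b) * h2
  · have h2 : (1 - a) * φ (t'' F) = 1 := by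
      rw [← h1, ← map_one φ, ← map_sub, ← map_mul, t'', one_sub_t_mul_inv]
    linear_combination c * h2 - φ (t'' F) * hac

variable [CharZero F] {L : Type*} [LieRing L] [LieAlgebra F L] {ι : sl2 F →ₗ[F] L}
  {G : Set (sl2 F →ₗ[F] L)} {J : Submodule F (sl2 F →ₗ[F] L)}

theorem IsClosedFamily.exists_loop_hom (h : IsClosedFamily ι G J) {α β γ : sl2 F →ₗ[F] L}
    (hα : α ∈ G) (hβ : β ∈ G) (hγ : γ ∈ G) (hαβ : Good α β (α - ι)) (hγα : Good γ α (γ - ι)) :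
    ∃ ψ : Loop F →ₗ⁅F⁆ L, ∀ s, ψ (1 ⊗ₜ s) = ι s ∧ ψ (t F ⊗ₜ s) = α s ∧ ψ (t' F ⊗ₜ s) = β s ∧
      ψ (t'' F ⊗ₜ s) = γ s := by
  -- Commutativity makes the centroid a legitimate target for the universal property of `A F`.
  let _ : CommRing (centroid F L) :=
    { (inferInstance : Ring (centroid F L)) with
      mul_comm := fun T U => Subtype.ext (h.centroid_comm T.2 U.2) }
  have hι : Good ι ι ι := h.equivariant ι (h.le h.mem)
  have heq : ∀ g ∈ G, Good ι g g := fun g hg => h.equivariant g (h.le hg)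
  have happ : ∀ g ∈ G, ∀ s, casimir ι g (ι s) = g s := fun g hg s =>
    casimir_apply_of_good hι (heq g hg).symm s
  let a : centroid F L := ⟨casimir ι α, h.casimir_mem hα⟩
  let b : centroid F L := ⟨casimir ι β, h.casimir_mem hβ⟩
  let c : centroid F L := ⟨casimir ι γ, h.casimir_mem hγ⟩
  have hab : a * (1 - b) = 1 := by
    refine Subtype.ext (h.eq_of_mem_centroid (a * (1 - b)).2 (1 : centroid F L).2 fun s => ?_)
    change casimir ι α (ι s - casimir ι β (ι s)) = ι s
    rw [map_sub, happ α hα, happ β hβ, casimir_apply_of_good (heq β hβ) hαβ, LinearMap.sub_apply,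
      sub_sub_cancel]
  have hac : (1 - a) * c = 1 := by
    refine Subtype.ext (h.eq_of_mem_centroid ((1 - a) * c).2 (1 : centroid F L).2 fun s => ?_)
    change casimir ι γ (ι s) - casimir ι α (casimir ι γ (ι s)) = ι s
    rw [happ γ hγ, casimir_apply_of_good (heq γ hγ) hγα.symm, LinearMap.sub_apply, sub_sub_cancel]
  obtain ⟨φ, h1, h2, h3⟩ := exists_algHom (F := F) hab hac
  have hφ : ∀ (a : A F) (x v : L), ⁅x, (φ a).1 v⁆ = (φ a).1 ⁅x, v⁆ := fun a => mem_centroid.1 (φ a).2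
  let ψ₀ : A F ⊗[F] sl2 F →ₗ[F] L := TensorProduct.lift
    (LinearMap.mk₂ F (fun a s => (φ a).1 (ι s))
      (fun a b s => by rw [map_add]; rfl) (fun r a s => by rw [map_smul]; rfl)
      (fun a s s' => by rw [map_add, map_add]) (fun r a s => by rw [map_smul, map_smul]))
  have hψ : ∀ a s, ψ₀ (a ⊗ₜ s) = (φ a).1 (ι s) := fun a s => rfl
  have hlie : ∀ u v : Loop F, ψ₀ (LieRing.toBracket.bracket u v) = ⁅ψ₀ u, ψ₀ v⁆ := by
    intro u v
    induction u using TensorProduct.induction_on with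
    | zero =>
      rw [map_zero, zero_lie]
      exact (congrArg ψ₀ (zero_lie v)).trans (map_zero ψ₀)
    | add x y hx hy =>
      rw [map_add, add_lie, ← hx, ← hy]
      exact (congrArg ψ₀ (add_lie x y v)).trans (map_add ψ₀ _ _)
    | tmul a s =>
      induction v using TensorProduct.induction_on with
      | zero =>
        rw [map_zero, lie_zero]
        exact (congrArg ψ₀ (lie_zero (a ⊗ₜ[F] s : Loop F))).trans (map_zero ψ₀)
      | add x y hx hy =>
        rw [map_add, lie_add, ← hx, ← hy]
        exact (congrArg ψ₀ (lie_add (a ⊗ₜ[F] s : Loop F) x y)).trans (map_add ψ₀ _ _)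
      | tmul b s' =>
        have e : ⁅(φ a).1 (ι s), ι s'⁆ = (φ a).1 ⁅ι s, ι s'⁆ := by
          rw [← lie_skew, hφ, ← map_neg, lie_skew]
        rw [LieAlgebra.ExtendScalars.bracket_tmul, hψ, hψ, hψ, ← hι, hφ, e, mul_comm a b, map_mul]
        rfl
  refine ⟨{ ψ₀ with map_lie' := hlie _ _ }, fun s => ⟨?_, ?_, ?_, ?_⟩⟩
  · change ψ₀ _ = _
    rw [hψ, map_one]
    rfl
  · change ψ₀ _ = _
    rw [hψ, h1]
    exact happ α hα s
  · change ψ₀ _ = _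
    rw [hψ, h2]
    exact happ β hβ s
  · change ψ₀ _ = _
    rw [hψ, h3]
    exact happ γ hγ s

/-- The coefficients `a` with `a ⊗ sl2` inside `K` form a subalgebra of `A F`, closed under products
because `sl2` is perfect. -/
theorem loop_subalgebra_eq_top {K : LieSubalgebra F (Loop F)} (h1 : ∀ s, (1 : A F) ⊗ₜ[F] s ∈ K)
    (h : ∀ s, t F ⊗ₜ[F] s ∈ K) (h' : ∀ s, t' F ⊗ₜ[F] s ∈ K) (h'' : ∀ s, t'' F ⊗ₜ[F] s ∈ K) :
    K = ⊤ := by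
  let B : Subalgebra F (A F) :=
    { carrier := {a | ∀ s, a ⊗ₜ[F] s ∈ K}
      mul_mem' := fun {a b} ha hb s =>
        sl2_mem_of_lie (S := K.toSubmodule) (γ := TensorProduct.mk F (A F) (sl2 F) (a * b))
          (fun u v => by
            have := K.lie_mem (ha u) (hb v)
            rwa [LieAlgebra.ExtendScalars.bracket_tmul] at this) s
      add_mem' := fun ha hb s => by rw [TensorProduct.add_tmul]; exact K.add_mem (ha s) (hb s)
      algebraMap_mem' := fun r s => by
        rw [Algebra.algebraMap_eq_smul_one, ← TensorProduct.smul_tmul']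
        exact K.smul_mem r (h1 s) }
  have hB : B = ⊤ := subalgebra_eq_top h h' h''
  rw [eq_top_iff]
  intro v _
  induction v using TensorProduct.induction_on with
  | zero => exact K.zero_mem
  | add x y hx hy => exact K.add_mem (hx trivial) (hy trivial)
  | tmul a s => exact (hB ▸ Algebra.mem_top : a ∈ B) s

end Localization

/-! ### The loop algebra as triples over `A F`. -/

section Coordinates

variable {F : Type*} [Field F]

/-- The element of the loop algebra with given coordinates with respect to `e`, `f`, `h`. -/
def coord (F : Type*) [Field F] : (A F × A F × A F) →ₗ[A F] Loop F where
  toFun v := v.1 ⊗ₜ[F] sl2e F + v.2.1 ⊗ₜ[F] sl2f F + v.2.2 ⊗ₜ[F] sl2h F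
  map_add' v w := by
    simp only [Prod.fst_add, Prod.snd_add, TensorProduct.add_tmul]
    abel
  map_smul' a v := by
    simp only [Prod.smul_fst, Prod.smul_snd, smul_add, TensorProduct.smul_tmul', RingHom.id_apply]

theorem coord_apply (v : A F × A F × A F) :
    coord F v = v.1 ⊗ₜ[F] sl2e F + v.2.1 ⊗ₜ[F] sl2f F + v.2.2 ⊗ₜ[F] sl2h F := rfl

theorem tmul_eq_coord (a : A F) (s : sl2 F) :
    a ⊗ₜ[F] s = coord F (s.1 0 1 • a, s.1 1 0 • a, s.1 0 0 • a) := by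
  conv_lhs => rw [sl2_eq s]
  simp only [coord_apply, TensorProduct.tmul_add, TensorProduct.tmul_smul,
    TensorProduct.smul_tmul']

/-- The coordinates of an element of the loop algebra. -/
def coordInv (F : Type*) [Field F] : Loop F →ₗ[F] (A F × A F × A F) :=
  TensorProduct.lift (LinearMap.mk₂ F (fun a s => (s.1 0 1 • a, s.1 1 0 • a, s.1 0 0 • a))
    (fun a b s => by simp only [smul_add, Prod.mk_add_mk])
    (fun r a s => by simp only [smul_comm r, Prod.smul_mk])
    (fun a s s' => by
      change ((s.1 + s'.1) 0 1 • a, (s.1 + s'.1) 1 0 • a, (s.1 + s'.1) 0 0 • a) = _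
      simp only [Matrix.add_apply, add_smul, Prod.mk_add_mk])
    (fun r a s => by
      change ((r • s.1) 0 1 • a, (r • s.1) 1 0 • a, (r • s.1) 0 0 • a) = _
      simp only [Matrix.smul_apply, smul_eq_mul, mul_smul, Prod.smul_mk]))

theorem coordInv_coord (v : A F × A F × A F) : coordInv F (coord F v) = v := by
  simp [coord_apply, coordInv, val_sl2e, val_sl2f, val_sl2h]

theorem coord_injective : Function.Injective (coord F) :=
  Function.LeftInverse.injective coordInv_coord

theorem coord_surjective : Function.Surjective (coord F) := by
  intro v
  induction v using TensorProduct.induction_on with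
  | zero => exact ⟨0, map_zero _⟩
  | add x y hx hy =>
    obtain ⟨v, rfl⟩ := hx
    obtain ⟨w, rfl⟩ := hy
    exact ⟨v + w, map_add _ _ _⟩
  | tmul a s => exact ⟨_, (tmul_eq_coord a s).symm⟩

/-- The bracket of the loop algebra in coordinates. -/
def cross (v w : A F × A F × A F) : A F × A F × A F :=
  (2 * (v.2.2 * w.1 - v.1 * w.2.2), 2 * (v.2.1 * w.2.2 - v.2.2 * w.2.1),
    v.1 * w.2.1 - v.2.1 * w.1)

theorem lie_coord (v w : A F × A F × A F) : ⁅coord F v, coord F w⁆ = coord F (cross v w) := by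
  rw [coord_apply, coord_apply]
  have h1 : ∀ x y z : Loop F, (⁅x + y, z⁆ : Loop F) = ⁅x, z⁆ + ⁅y, z⁆ := fun x y z => add_lie x y z
  have h2 : ∀ x y z : Loop F, (⁅x, y + z⁆ : Loop F) = ⁅x, y⁆ + ⁅x, z⁆ := fun x y z => lie_add x y z
  simp only [h1, h2, LieAlgebra.ExtendScalars.bracket_tmul, lie_self, lie_h_e, lie_h_f, lie_e_f,
    lie_e_h, lie_f_h, lie_f_e, two_smul, TensorProduct.tmul_neg, TensorProduct.tmul_add,
    TensorProduct.tmul_zero, coord_apply, cross]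
  simp only [zero_add, add_zero, mul_sub, two_mul, TensorProduct.sub_tmul, TensorProduct.add_tmul]
  abel

/-- The hypothesis says that the matrix of `v` has determinant -1, so `ad v` is annihilated by `X (X
- 2) (X + 2)`. -/
theorem cross_cross_cross {v : A F × A F × A F} (hv : v.2.2 ^ 2 + v.1 * v.2.1 = 1)
    (w : A F × A F × A F) : cross v (cross v (cross v w)) = (4 : F) • cross v w := by
  have h4 : ∀ a : A F, (4 : F) • a = 4 * a := fun a => by
    rw [Algebra.smul_def, map_ofNat]
  simp only [cross, Prod.smul_mk, h4, Prod.mk.injEq]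
  refine ⟨?_, ?_, ?_⟩
  · linear_combination 8 * (v.2.2 * w.1 - v.1 * w.2.2) * hv
  · linear_combination 8 * (v.2.1 * w.2.2 - v.2.2 * w.2.1) * hv
  · linear_combination 4 * (v.1 * w.2.1 - v.2.1 * w.1) * hv

theorem eq_smul_of_cross_eq_zero [CharZero F] {v w : A F × A F × A F}
    (hv : v.2.2 ^ 2 + v.1 * v.2.1 = 1) (h : cross v w = 0) : ∃ a : A F, a • v = w := by
  have h2 : ∀ a : A F, 2 * a = 0 → a = 0 := fun a ha => by
    have : (2 : F) • a = 0 := by rw [Algebra.smul_def, map_ofNat, ha]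
    exact (smul_eq_zero.1 this).resolve_left two_ne_zero
  obtain ⟨he, hf, hh⟩ : _ ∧ _ ∧ _ := by simpa only [cross, Prod.mk_eq_zero] using h
  have he := h2 _ he
  have hf := h2 _ hf
  -- This is half the trace of the matrix product, as `v.1 * w.2.1 = v.2.1 * w.1`; for `w = a • v`
  -- it returns `a`.
  refine ⟨v.2.2 * w.2.2 + v.1 * w.2.1, ?_⟩
  ext <;> simp only [Prod.smul_fst, Prod.smul_snd, smul_eq_mul]
  · linear_combination w.1 * hv - v.2.2 * he + v.1 * hh
  · linear_combination w.2.1 * hv + v.2.2 * hf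
  · linear_combination w.2.2 * hv - v.1 * hf

theorem cross_smul_self (v : A F × A F × A F) (a : A F) : cross v (a • v) = 0 := by
  simp only [cross, Prod.smul_fst, Prod.smul_snd, smul_eq_mul, Prod.mk_eq_zero]
  exact ⟨by ring, by ring, by ring⟩

end Coordinates

/-! ### The defining relations checked on the images of the generators. -/

section Generators

variable (F : Type*) [Field F]

/-- The coordinates of the images of the standard generators in the loop algebra. -/
def genVal : Fin 4 → Fin 4 → A F × A F × A F :=
  ![![0, (-(2 * tInv F), 0, 1), (2 * t'' F, 2 - 2 * t'' F, 1 - 2 * t'' F), (0, -(2 * t F), -1)],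
    ![(2 * tInv F, 0, -1), 0, (2, 0, -1), (0, 0, -1)],
    ![(-(2 * t'' F), 2 * t'' F - 2, 2 * t'' F - 1), (-2, 0, 1), 0, (0, -2, -1)],
    ![(0, 2 * t F, 1), (0, 0, 1), (0, 2, 1), 0]]

theorem genVal_antisymm (i j : Fin 4) : genVal F i j + genVal F j i = 0 := by
  fin_cases i <;> fin_cases j <;> simp [genVal]

theorem genVal_norm (i j : Fin 4) (hij : i ≠ j) :
    (genVal F i j).2.2 ^ 2 + (genVal F i j).1 * (genVal F i j).2.1 = 1 := by
  fin_cases i <;> fin_cases j <;> first | exact absurd rfl hij | (simp [genVal] <;> ring)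

theorem t_mul_t'' : t F * t'' F = t'' F - 1 := by
  have := one_sub_t_mul_inv F
  rw [t'']
  linear_combination -this

theorem tInv_mul_t'' : tInv F * t'' F = tInv F + t'' F := by
  linear_combination -(tInv F) * t_mul_t'' F + t'' F * t_mul_tInv F

theorem genVal_triangle (h i j : Fin 4) (hhi : h ≠ i) (hij : i ≠ j) (hhj : h ≠ j) :
    cross (genVal F h i) (genVal F i j) = (2 : A F) • genVal F h i + (2 : A F) • genVal F i j := by
  have e1 := t_mul_tInv F
  have e2 := t_mul_t'' F
  have e3 := tInv_mul_t'' F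
  fin_cases h <;> fin_cases i <;> first | exact absurd rfl hhi | skip
  all_goals fin_cases j <;> first | exact absurd rfl hij | exact absurd rfl hhj | skip
  all_goals
    simp [genVal, cross]
    try grind

end Generators

/-! ### Relations and universal property of the tetrahedron algebra. -/

section Presentation

variable (F : Type*) [Field F]

/-- The projection from the free Lie algebra onto the tetrahedron algebra. -/
def mkHom : FreeLieAlgebra F Gen →ₗ⁅F⁆ Tet F :=
  { (relIdeal F).toSubmodule.mkQ with
    map_lie' := fun {x y} => LieSubmodule.Quotient.mk_bracket (I := relIdeal F) x y }

theorem mkHom_freeX (i j : Fin 4) (hij : i ≠ j) : mkHom F (freeX F i j hij) = gen F i j hij := rfl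

theorem mkHom_surjective : Function.Surjective (mkHom F) :=
  (relIdeal F).toSubmodule.mkQ_surjective

theorem mkHom_relator {r : FreeLieAlgebra F Gen} (h : Relator F r) : mkHom F r = 0 :=
  LieSubmodule.Quotient.mk_eq_zero'.2 (LieSubmodule.subset_lieSpan h)

theorem gen_antisymm (i j : Fin 4) (hij : i ≠ j) : gen F i j hij = -gen F j i hij.symm := by
  have := mkHom_relator F (Relator.antisymm i j hij)
  rw [map_add, mkHom_freeX, mkHom_freeX] at this
  exact eq_neg_of_add_eq_zero_left this

theorem gen_triangle (h i j : Fin 4) (hhi : h ≠ i) (hij : i ≠ j) (hhj : h ≠ j) :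
    ⁅gen F h i hhi, gen F i j hij⁆ = (2 : F) • gen F h i hhi + (2 : F) • gen F i j hij := by
  have := mkHom_relator F (Relator.triangle h i j hhi hij hhj)
  simpa only [map_sub, map_add, map_smul, LieHom.map_lie, mkHom_freeX, sub_eq_zero] using this

theorem gen_dolanGrady (h i j k : Fin 4) (hhi : h ≠ i) (hhj : h ≠ j) (hhk : h ≠ k)
    (hij : i ≠ j) (hik : i ≠ k) (hjk : j ≠ k) :
    ⁅gen F h i hhi, ⁅gen F h i hhi, ⁅gen F h i hhi, gen F j k hjk⁆⁆⁆ =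
      (4 : F) • ⁅gen F h i hhi, gen F j k hjk⁆ := by
  have := mkHom_relator F (Relator.dolanGrady h i j k hhi hhj hhk hij hik hjk)
  simpa only [map_sub, map_smul, LieHom.map_lie, mkHom_freeX, sub_eq_zero] using this

variable {F}

theorem tet_subalgebra_eq_top {K : LieSubalgebra F (Tet F)} (h12 : gen F 1 2 ∈ K)
    (h23 : gen F 2 3 ∈ K) (h31 : gen F 3 1 ∈ K) (h03 : gen F 0 3 ∈ K) (h01 : gen F 0 1 ∈ K)
    (h02 : gen F 0 2 ∈ K) : K = ⊤ := by
  have hK : ∀ p : Gen, gen F p.1.1 p.1.2 p.2 ∈ K := by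
    have hneg : ∀ (i j : Fin 4) (hij : i ≠ j), gen F j i hij.symm ∈ K → gen F i j hij ∈ K :=
      fun i j hij h => by rw [gen_antisymm]; exact K.neg_mem h
    rintro ⟨⟨i, j⟩, hij⟩
    fin_cases i <;> fin_cases j <;>
      first | exact absurd rfl hij | assumption | (apply hneg; assumption)
  -- The projection from the free Lie algebra factors through `K`, and it is surjective.
  let f : FreeLieAlgebra F Gen →ₗ⁅F⁆ K :=
    FreeLieAlgebra.lift F fun p => ⟨gen F p.1.1 p.1.2 p.2, hK p⟩
  have hf : K.incl.comp f = mkHom F := by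
    refine FreeLieAlgebra.hom_ext fun p => ?_
    rw [LieHom.comp_apply, FreeLieAlgebra.lift_of_apply]
    rfl
  rw [eq_top_iff]
  intro v _
  obtain ⟨w, rfl⟩ := mkHom_surjective F v
  rw [← hf]
  exact (f w).2

theorem tet_hom_ext {L : Type*} [LieRing L] [LieAlgebra F L] {σ τ : Tet F →ₗ⁅F⁆ L}
    (h12 : σ (gen F 1 2) = τ (gen F 1 2)) (h23 : σ (gen F 2 3) = τ (gen F 2 3))
    (h31 : σ (gen F 3 1) = τ (gen F 3 1)) (h03 : σ (gen F 0 3) = τ (gen F 0 3))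
    (h01 : σ (gen F 0 1) = τ (gen F 0 1)) (h02 : σ (gen F 0 2) = τ (gen F 0 2)) : σ = τ := by
  let K : LieSubalgebra F (Tet F) :=
    { LinearMap.eqLocus (σ : Tet F →ₗ[F] L) (τ : Tet F →ₗ[F] L) with
      lie_mem' := fun {x y} hx hy => by
        have hx' : σ x = τ x := hx
        have hy' : σ y = τ y := hy
        change σ ⁅x, y⁆ = τ ⁅x, y⁆
        rw [LieHom.map_lie, LieHom.map_lie, hx', hy'] }
  have hK : K = ⊤ := tet_subalgebra_eq_top h12 h23 h31 h03 h01 h02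
  ext v
  exact (hK ▸ LieSubalgebra.mem_top v : v ∈ K)

/-- The universal property of the tetrahedron algebra. -/
def tetLift {L : Type*} [LieRing L] [LieAlgebra F L] (f : FreeLieAlgebra F Gen →ₗ⁅F⁆ L)
    (hf : ∀ r, Relator F r → f r = 0) : Tet F →ₗ⁅F⁆ L :=
  have hle : relIdeal F ≤ f.ker := LieSubmodule.lieSpan_le.2 fun r hr => f.mem_ker.2 (hf r hr)
  { (relIdeal F).toSubmodule.liftQ (f : FreeLieAlgebra F Gen →ₗ[F] L)
      (fun r hr => f.mem_ker.1 (hle hr)) with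
    map_lie' := fun {x y} => by
      obtain ⟨x, rfl⟩ := mkHom_surjective F x
      obtain ⟨y, rfl⟩ := mkHom_surjective F y
      rw [← LieHom.map_lie]
      exact f.map_lie x y }

theorem tetLift_gen {L : Type*} [LieRing L] [LieAlgebra F L] (f : FreeLieAlgebra F Gen →ₗ⁅F⁆ L)
    (hf : ∀ r, Relator F r → f r = 0) (i j : Fin 4) (hij : i ≠ j) :
    tetLift f hf (gen F i j hij) = f (freeX F i j hij) := rfl

theorem exists_tet_hom : ∃ σ : Tet F →ₗ⁅F⁆ Loop F,
    ∀ (i j : Fin 4) (hij : i ≠ j), σ (gen F i j hij) = coord F (genVal F i j) := by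
  let f : FreeLieAlgebra F Gen →ₗ⁅F⁆ Loop F :=
    FreeLieAlgebra.lift F fun p => coord F (genVal F p.1.1 p.1.2)
  have hf : ∀ (i j : Fin 4) (hij : i ≠ j), f (freeX F i j hij) = coord F (genVal F i j) :=
    fun i j hij => FreeLieAlgebra.lift_of_apply _ _
  have h2 : ∀ v : Loop F, (2 : F) • v = (2 : A F) • v := fun v => by
    rw [two_smul, two_smul]
  refine ⟨tetLift f fun r hr => ?_, fun i j hij => by rw [tetLift_gen, hf]⟩
  cases hr with
  | antisymm i j hij => rw [map_add, hf, hf, ← map_add, genVal_antisymm, map_zero]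
  | triangle h i j hhi hij hhj =>
    rw [map_sub, LieHom.map_lie, map_add, map_smul, map_smul, hf, hf, lie_coord,
      genVal_triangle F h i j hhi hij hhj, h2, h2, map_add, map_smul, map_smul, sub_self]
  | dolanGrady h i j k hhi hhj hhk hij hik hjk =>
    rw [map_sub, map_smul, LieHom.map_lie, LieHom.map_lie, LieHom.map_lie, hf, hf, lie_coord,
      lie_coord, lie_coord, cross_cross_cross (genVal_norm F h i hhi),
      (coord F).map_smul_of_tower, sub_self]

end Presentation

/-! ### The three families of powers in the tetrahedron algebra. -/

section Family

variable {F : Type*} [Field F]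

/-- The embedding of `sl2` in the tetrahedron algebra. -/
def sl2ToTet (F : Type*) [Field F] : sl2 F →ₗ[F] Tet F :=
  sl2Lift ((2⁻¹ : F) • (gen F 1 2 + gen F 3 1)) (-((2⁻¹ : F) • (gen F 2 3 + gen F 3 1))) (gen F 3 1)

theorem sl2ToTet_eqz : sl2ToTet F (eqz F) = gen F 3 1 := by
  rw [eqz, sl2ToTet, sl2Lift_h]

theorem lie_gen_zero (i j : Fin 4) (hi : 0 ≠ i) (hj : 0 ≠ j) (hij : i ≠ j) :
    ⁅gen F 0 i hi, gen F 0 j hj⁆ = (2 : F) • gen F 0 i hi - (2 : F) • gen F 0 j hj := by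
  have := gen_triangle F i 0 j hi.symm hj hij
  rw [gen_antisymm F i 0 hi.symm, neg_lie] at this
  linear_combination (norm := module) -this

variable [CharZero F]

theorem sl2ToTet_eqx : sl2ToTet F (eqx F) = gen F 1 2 := by
  rw [eqx, map_sub, map_smul, sl2ToTet, sl2Lift_e, sl2Lift_h]
  module

theorem sl2ToTet_eqy : sl2ToTet F (eqy F) = gen F 2 3 := by
  rw [eqy, map_sub, map_neg, map_smul, sl2ToTet, sl2Lift_f, sl2Lift_h]
  module

theorem sl2ToTet_good : Good (sl2ToTet F) (sl2ToTet F) (sl2ToTet F) := by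
  have hxy := gen_triangle F 1 2 3 (by decide) (by decide) (by decide)
  have hyz := gen_triangle F 2 3 1 (by decide) (by decide) (by decide)
  have hzx := gen_triangle F 3 1 2 (by decide) (by decide) (by decide)
  have hyx := lie_skew (gen F 2 3) (gen F 1 2)
  have hzy := lie_skew (gen F 3 1) (gen F 2 3)
  have hxz := lie_skew (gen F 1 2) (gen F 3 1)
  rw [hxy] at hyx
  rw [hyz] at hzy
  rw [hzx] at hxz
  apply good_of_basis <;>
    simp only [sl2ToTet, sl2Lift_e, sl2Lift_f, sl2Lift_h, lie_add, add_lie, lie_neg, neg_lie,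
      lie_smul, smul_lie, lie_self, hxy, hyz, hzx, ← hyx, ← hzy, ← hxz] <;> module

theorem exists_powers_tet {ι : sl2 F →ₗ[F] Tet F} (hι : Good ι ι ι) {i j k : Fin 4} (hij : i ≠ j)
    (hjk : j ≠ k) (hki : k ≠ i) (hi : 0 ≠ i) (hj : 0 ≠ j) (hk : 0 ≠ k)
    (hx : ι (eqx F) = gen F i j hij) (hy : ι (eqy F) = gen F j k hjk)
    (hz : ι (eqz F) = gen F k i hki) :
    ∃ P : ℕ → sl2 F →ₗ[F] Tet F, IsPowers ι P ∧
      gen F 0 k hk = P 1 (eqy F + eqz F) - ι (eqz F) := by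
  apply exists_powers hι
  · have := gen_triangle F j k 0 hjk hk.symm hj.symm
    rw [gen_antisymm F k 0 hk.symm, lie_neg] at this
    rw [hy]
    linear_combination (norm := module) -this
  · have := gen_triangle F 0 k i hk hki hi
    rw [← lie_skew] at this
    rw [hz]
    linear_combination (norm := module) -this
  · rw [hx]
    exact gen_dolanGrady F i j 0 k hij hi.symm hki.symm hj.symm hjk hk
  · rw [hx]
    exact gen_dolanGrady F 0 k i j hk hi hj hki hjk.symm hij

/-- The data controlling the tetrahedron algebra: three families of powers, corresponding to `t`,
`t'` and `t''`. -/
theorem exists_families : ∃ P Q R : ℕ → sl2 F →ₗ[F] Tet F,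
    IsPowers (sl2ToTet F) P ∧ IsPowers (sl2ToTet F) Q ∧ IsPowers (sl2ToTet F) R ∧
    gen F 0 3 = P 1 (eqy F + eqz F) - sl2ToTet F (eqz F) ∧
    gen F 0 1 = Q 1 (eqz F + eqx F) - sl2ToTet F (eqx F) ∧
    gen F 0 2 = R 1 (eqx F + eqy F) - sl2ToTet F (eqy F) ∧
    Good (P 1) (Q 1) (P 1 - sl2ToTet F) ∧ Good (Q 1) (R 1) (Q 1 - sl2ToTet F) ∧
    Good (R 1) (P 1) (R 1 - sl2ToTet F) := by
  have hι := sl2ToTet_good (F := F)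
  have hx := sl2ToTet_eqx (F := F)
  have hy := sl2ToTet_eqy (F := F)
  have hz := sl2ToTet_eqz (F := F)
  generalize sl2ToTet F = ι at *
  -- Precomposing with the rotation permutes the indices 1, 2, 3 cyclically, so `x_01` and `x_02`
  -- take the place of `x_03`.
  have hι' : Good (ι ∘ₗ rot F) (ι ∘ₗ rot F) (ι ∘ₗ rot F) := good_comp_rot.2 hι
  have hι'' : Good ((ι ∘ₗ rot F) ∘ₗ rot F) ((ι ∘ₗ rot F) ∘ₗ rot F) ((ι ∘ₗ rot F) ∘ₗ rot F) :=
    good_comp_rot.2 hι'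
  obtain ⟨P, hP, hp⟩ := exists_powers_tet hι (i := 1) (j := 2) (k := 3) (by decide) (by decide)
    (by decide) (by decide) (by decide) (by decide) hx hy hz
  obtain ⟨Q₀, hQ₀, hq⟩ := exists_powers_tet hι' (i := 2) (j := 3) (k := 1) (by decide) (by decide)
    (by decide) (by decide) (by decide) (by decide) (by rw [LinearMap.comp_apply, rot_eqx, hy])
    (by rw [LinearMap.comp_apply, rot_eqy, hz]) (by rw [LinearMap.comp_apply, rot_eqz, hx])
  obtain ⟨R₀, hR₀, hr⟩ := exists_powers_tet hι'' (i := 3) (j := 1) (k := 2) (by decide) (by decide)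
    (by decide) (by decide) (by decide) (by decide)
    (by rw [LinearMap.comp_apply, LinearMap.comp_apply, rot_eqx, rot_eqy, hz])
    (by rw [LinearMap.comp_apply, LinearMap.comp_apply, rot_eqy, rot_eqz, hx])
    (by rw [LinearMap.comp_apply, LinearMap.comp_apply, rot_eqz, rot_eqx, hy])
  obtain ⟨Q, hQ, hQ'⟩ := hQ₀.exists_comp_rot
  obtain ⟨R₁, hR₁, hR₁'⟩ := hR₀.exists_comp_rot
  obtain ⟨R, hR, hR'⟩ := hR₁.exists_comp_rot
  rw [hQ'] at hq
  rw [hR₁', hR'] at hr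
  have hq' : gen F 0 1 = Q 1 (eqz F + eqx F) - ι (eqx F) := by
    rw [hq]
    simp only [LinearMap.comp_apply, map_add, rot_eqy, rot_eqz]
  have hr' : gen F 0 2 = R 1 (eqx F + eqy F) - ι (eqy F) := by
    rw [hr]
    simp only [LinearMap.comp_apply, map_add, rot_eqx, rot_eqy, rot_eqz]
  have eP := hP.equivariant 1
  have eQ := hQ.equivariant 1
  have eR := hR.equivariant 1
  refine ⟨P, Q, R, hP, hQ, hR, hp, hq', hr', ?_, ?_, ?_⟩
  · exact good_of_triangle hι eP eQ hp hq' (lie_gen_zero 3 1 _ _ (by decide))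
  · rw [← good_comp_rot]
    refine good_of_triangle hι' (good_comp_rot.2 eQ) (good_comp_rot.2 eR) hq ?_
      (lie_gen_zero 1 2 (by decide) (by decide) (by decide))
    rw [hr']
    simp only [LinearMap.comp_apply, map_add, rot_eqx, rot_eqz]
  · rw [← good_comp_rot, ← good_comp_rot]
    refine good_of_triangle hι'' (good_comp_rot.2 (good_comp_rot.2 eR))
      (good_comp_rot.2 (good_comp_rot.2 eP)) hr ?_ (lie_gen_zero 2 3 (by decide) (by decide) (by decide))
    rw [hp]
    simp only [LinearMap.comp_apply, map_add, rot_eqx, rot_eqy, rot_eqz]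

end Family

/-! ### Closure of the span of the powers under multiplication. -/

section Closed

variable {F : Type*} [Field F] [CharZero F] {L : Type*} [LieRing L] [LieAlgebra F L]
  {ι : sl2 F →ₗ[F] L} {P Q R : ℕ → sl2 F →ₗ[F] L}

theorem exists_mul_mem (hP : IsPowers ι P) (hQ : IsPowers ι Q) (hR : IsPowers ι R)
    (hPQ : Good (P 1) (Q 1) (P 1 - ι)) (hRP : Good (R 1) (P 1) (R 1 - ι))
    {J : Submodule F (sl2 F →ₗ[F] L)} (hJ : ∀ n, P n ∈ J ∧ Q n ∈ J ∧ R n ∈ J) (n : ℕ) :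
    (∃ γ ∈ J, Good (P 1) (P n) γ) ∧ (∃ γ ∈ J, Good (P 1) (Q n) γ) ∧
      ∃ γ ∈ J, Good (P 1) (R n) γ := by
  refine ⟨⟨_, (hJ _).1, hP.2 1 n⟩, ⟨_, ?_, hP.cross_right hQ hPQ n⟩, ?_⟩
  · exact J.sub_mem (hJ 1).1 (J.sum_mem fun k _ => (hJ k).2.1)
  · cases n with
    | zero => exact ⟨P 1, (hJ 1).1, hR.1 ▸ (hP.equivariant 1).symm⟩
    | succ n => exact ⟨_, J.sub_mem (hJ _).2.2 (hJ _).2.2, hR.cross_left hRP n⟩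

theorem isClosedFamily_of_powers (hP : IsPowers ι P) (hQ : IsPowers ι Q) (hR : IsPowers ι R)
    (hPQ : Good (P 1) (Q 1) (P 1 - ι)) (hQR : Good (Q 1) (R 1) (Q 1 - ι))
    (hRP : Good (R 1) (P 1) (R 1 - ι))
    (hgen : ∀ K : LieSubalgebra F L, (∀ s, ι s ∈ K) → (∀ s, P 1 s ∈ K) → (∀ s, Q 1 s ∈ K) →
      (∀ s, R 1 s ∈ K) → K = ⊤) :
    IsClosedFamily ι {ι, P 1, Q 1, R 1}
      (Submodule.span F (Set.range P ∪ Set.range Q ∪ Set.range R)) := by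
  set J := Submodule.span F (Set.range P ∪ Set.range Q ∪ Set.range R) with hJdef
  have hJP : ∀ n, P n ∈ J := fun n => Submodule.subset_span (Or.inl (Or.inl ⟨n, rfl⟩))
  have hJQ : ∀ n, Q n ∈ J := fun n => Submodule.subset_span (Or.inl (Or.inr ⟨n, rfl⟩))
  have hJR : ∀ n, R n ∈ J := fun n => Submodule.subset_span (Or.inr ⟨n, rfl⟩)
  -- Products are linear in the second factor, so the spanning powers suffice; the three nontrivial
  -- multipliers are then related by cyclic symmetry.
  have ind : ∀ g, (∀ n, (∃ γ ∈ J, Good g (P n) γ) ∧ (∃ γ ∈ J, Good g (Q n) γ) ∧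
      ∃ γ ∈ J, Good g (R n) γ) → ∀ β ∈ J, ∃ γ ∈ J, Good g β γ := by
    intro g hg β hβ
    induction hβ using Submodule.span_induction with
    | mem β hβ =>
      obtain (⟨n, rfl⟩ | ⟨n, rfl⟩) | ⟨n, rfl⟩ := hβ
      · exact (hg n).1
      · exact (hg n).2.1
      · exact (hg n).2.2
    | zero => exact ⟨0, J.zero_mem, fun a b => lie_zero _⟩
    | add x y _ _ hx hy =>
      obtain ⟨γ, hγ, h⟩ := hx
      obtain ⟨γ', hγ', h'⟩ := hy
      exact ⟨γ + γ', J.add_mem hγ hγ', h.add_right h'⟩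
    | smul r x _ hx =>
      obtain ⟨γ, hγ, h⟩ := hx
      exact ⟨r • γ, J.smul_mem r hγ, h.smul_right r⟩
  have heq : ∀ β ∈ J, Good ι β β := by
    intro β hβ
    induction hβ using Submodule.span_induction with
    | mem β hβ =>
      obtain (⟨n, rfl⟩ | ⟨n, rfl⟩) | ⟨n, rfl⟩ := hβ
      · exact hP.equivariant n
      · exact hQ.equivariant n
      · exact hR.equivariant n
    | zero => exact fun a b => lie_zero _
    | add x y _ _ hx hy => exact hx.add_right hy
    | smul r x _ hx => exact hx.smul_right r
  refine ⟨by simp, ?_, heq, ?_, ?_⟩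
  · rintro g (rfl | rfl | rfl | rfl)
    · exact hP.1 ▸ hJP 0
    · exact hJP 1
    · exact hJQ 1
    · exact hJR 1
  · rintro g (rfl | rfl | rfl | rfl)
    · exact fun β hβ => ⟨β, hβ, heq β hβ⟩
    · exact ind _ (exists_mul_mem hP hQ hR hPQ hRP fun n => ⟨hJP n, hJQ n, hJR n⟩)
    · refine ind _ fun n => ?_
      have := exists_mul_mem hQ hR hP hQR hPQ (fun n => ⟨hJQ n, hJR n, hJP n⟩) n
      exact ⟨this.2.2, this.1, this.2.1⟩
    · refine ind _ fun n => ?_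
      have := exists_mul_mem hR hP hQ hRP hQR (fun n => ⟨hJR n, hJP n, hJQ n⟩) n
      exact ⟨this.2.1, this.2.2, this.1⟩
  · intro K hK
    exact hgen K (hK _ (by simp)) (hK _ (by simp)) (hK _ (by simp)) (hK _ (by simp))

end Closed

/-! ### Matching coordinates with the prescribed images. -/

section StandardValues

variable {F : Type*} [Field F]

theorem coord_smul_tmul (a b c : A F) : coord F (a, b, c) =
    a ⊗ₜ[F] sl2e F + b ⊗ₜ[F] sl2f F + c ⊗ₜ[F] sl2h F := rfl

theorem tmul_eqx (a : A F) : a ⊗ₜ[F] eqx F = coord F (2 * a, 0, -a) := by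
  rw [coord_smul_tmul, eqx, TensorProduct.tmul_sub, two_smul, TensorProduct.tmul_add, two_mul,
    TensorProduct.add_tmul, TensorProduct.zero_tmul, TensorProduct.neg_tmul]
  abel

theorem tmul_eqy (a : A F) : a ⊗ₜ[F] eqy F = coord F (0, -(2 * a), -a) := by
  rw [coord_smul_tmul, eqy, TensorProduct.tmul_sub, TensorProduct.tmul_neg, two_smul,
    TensorProduct.tmul_add, two_mul, TensorProduct.neg_tmul, TensorProduct.add_tmul,
    TensorProduct.zero_tmul, TensorProduct.neg_tmul]
  abel

theorem tmul_eqz (a : A F) : a ⊗ₜ[F] eqz F = coord F (0, 0, a) := by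
  rw [coord_smul_tmul, eqz, TensorProduct.zero_tmul, TensorProduct.zero_tmul, zero_add, zero_add]

variable (F)

theorem coord_genVal_one_two : coord F (genVal F 1 2) = (1 : A F) ⊗ₜ[F] eqx F := by
  rw [tmul_eqx]
  simp [genVal]

theorem coord_genVal_two_three : coord F (genVal F 2 3) = (1 : A F) ⊗ₜ[F] eqy F := by
  rw [tmul_eqy]
  simp [genVal]

theorem coord_genVal_three_one : coord F (genVal F 3 1) = (1 : A F) ⊗ₜ[F] eqz F := by
  rw [tmul_eqz]
  simp [genVal]

theorem coord_genVal_zero_three : coord F (genVal F 0 3) =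
    t F ⊗ₜ[F] eqy F + (t F - 1) ⊗ₜ[F] eqz F := by
  rw [tmul_eqy, tmul_eqz, ← map_add]
  congr 1
  simp only [genVal, Matrix.cons_val_zero, Matrix.cons_val, Prod.mk_add_mk, Prod.mk.injEq]
  exact ⟨by ring, by ring, by ring⟩

theorem coord_genVal_zero_one : coord F (genVal F 0 1) =
    t' F ⊗ₜ[F] eqz F + (t' F - 1) ⊗ₜ[F] eqx F := by
  rw [tmul_eqx, tmul_eqz, ← map_add]
  simp [genVal, t']

theorem coord_genVal_zero_two : coord F (genVal F 0 2) =
    t'' F ⊗ₜ[F] eqx F + (t'' F - 1) ⊗ₜ[F] eqy F := by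
  rw [tmul_eqx, tmul_eqy, ← map_add]
  congr 1
  simp only [genVal, Matrix.cons_val_zero, Matrix.cons_val, Prod.mk_add_mk, Prod.mk.injEq]
  exact ⟨by ring, by ring, by ring⟩

end StandardValues

/-! ### Surjectivity, the left inverse and the isomorphism. -/

section Isomorphism

variable {F : Type*} [Field F] [CharZero F]

theorem eq_top_of_sl2e_mem {S : Submodule F (sl2 F)} (hS : ∀ s : sl2 F, ∀ v ∈ S, ⁅s, v⁆ ∈ S)
    (he : sl2e F ∈ S) (s : sl2 F) : s ∈ S := by
  have hh : sl2h F ∈ S := by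
    have := S.neg_mem (hS (sl2f F) _ he)
    rwa [lie_f_e, neg_neg] at this
  refine sl2_mem_of_basis he ?_ hh s
  have := S.smul_mem (2⁻¹ : F) (hS (sl2f F) _ hh)
  rwa [lie_f_h, smul_smul, inv_mul_cancel₀ two_ne_zero, one_smul] at this

theorem eq_top_of_lie_lie_mem {S : Submodule F (sl2 F)} (hS : ∀ s : sl2 F, ∀ v ∈ S, ⁅s, v⁆ ∈ S)
    {v : sl2 F} (hv : v ∈ S) {r : F} (hr : r ≠ 0) (h : ⁅sl2e F, ⁅sl2e F, v⁆⁆ = r • sl2e F)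
    (s : sl2 F) : s ∈ S := by
  refine eq_top_of_sl2e_mem hS ?_ s
  have := S.smul_mem r⁻¹ (hS (sl2e F) _ (hS (sl2e F) _ hv))
  rwa [h, smul_smul, inv_mul_cancel₀ hr, one_smul] at this

theorem tet_hom_surjective {σ : Tet F →ₗ⁅F⁆ Loop F}
    (hσ : ∀ (i j : Fin 4) (hij : i ≠ j), σ (gen F i j hij) = coord F (genVal F i j)) :
    σ.range = ⊤ := by
  have hmem : ∀ (i j : Fin 4), i ≠ j → coord F (genVal F i j) ∈ σ.range := fun i j hij =>
    (σ.mem_range _).2 ⟨gen F i j hij, hσ i j hij⟩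
  generalize σ.range = K at hmem
  have hx := hmem 1 2 (by decide)
  have hy := hmem 2 3 (by decide)
  have hz := hmem 3 1 (by decide)
  have hp := hmem 0 3 (by decide)
  have hq := hmem 0 1 (by decide)
  have hr := hmem 0 2 (by decide)
  rw [coord_genVal_one_two] at hx
  rw [coord_genVal_two_three] at hy
  rw [coord_genVal_three_one] at hz
  rw [coord_genVal_zero_three] at hp
  rw [coord_genVal_zero_one] at hq
  rw [coord_genVal_zero_two] at hr
  -- Once `S 1` is everything, each `S a` is an `sl2`-submodule, and one suitable nonzero vector
  -- fills it by irreducibility.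
  let S : A F → Submodule F (sl2 F) := fun a =>
    K.toSubmodule.comap (TensorProduct.mk F (A F) (sl2 F) a)
  have hS : ∀ a s, s ∈ S a ↔ a ⊗ₜ[F] s ∈ K := fun a s => Iff.rfl
  have h1 : ∀ s, s ∈ S 1 := by
    have hx' : eqx F ∈ S 1 := hx
    have hy' : eqy F ∈ S 1 := hy
    have hz' : sl2h F ∈ S 1 := hz
    refine sl2_mem_of_basis ?_ ?_ hz'
    · have := (S 1).smul_mem (2⁻¹ : F) ((S 1).add_mem hx' hz')
      rwa [eqx, sub_add_cancel, smul_smul, inv_mul_cancel₀ two_ne_zero, one_smul] at this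
    · have := (S 1).smul_mem (-2⁻¹ : F) ((S 1).add_mem hy' hz')
      rwa [eqy, sub_add_cancel, smul_neg, neg_smul, neg_neg, smul_smul,
        inv_mul_cancel₀ two_ne_zero, one_smul] at this
  have hlie : ∀ a, ∀ s : sl2 F, ∀ v ∈ S a, ⁅s, v⁆ ∈ S a := by
    intro a s v hv
    have := K.lie_mem (h1 s) hv
    rwa [TensorProduct.mk_apply, TensorProduct.mk_apply, LieAlgebra.ExtendScalars.bracket_tmul,
      one_mul] at this
  apply loop_subalgebra_eq_top h1
  · refine fun s => eq_top_of_lie_lie_mem (hlie _) (v := eqy F + eqz F) ?_ (r := 4) (by norm_num) ?_ s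
    · rw [hS, TensorProduct.tmul_add]
      have := K.add_mem hp (h1 (eqz F))
      rwa [TensorProduct.mk_apply, TensorProduct.sub_tmul, add_assoc, sub_add_cancel] at this
    · simp only [eqy_add_eqz, lie_neg, lie_smul, lie_e_f, lie_e_h]
      module
  · refine fun s => eq_top_of_sl2e_mem (hlie _) ?_ s
    rw [hS]
    have := K.smul_mem (2⁻¹ : F) (K.add_mem hq (h1 (eqx F)))
    rwa [TensorProduct.mk_apply, TensorProduct.sub_tmul, add_assoc, sub_add_cancel,
      ← TensorProduct.tmul_add, eqz_add_eqx, ← TensorProduct.tmul_smul, smul_smul,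
      inv_mul_cancel₀ two_ne_zero, one_smul] at this
  · refine fun s => eq_top_of_lie_lie_mem (hlie _) (v := eqx F + eqy F) ?_ (r := 4) (by norm_num) ?_ s
    · rw [hS, TensorProduct.tmul_add]
      have := K.add_mem hr (h1 (eqy F))
      rwa [TensorProduct.mk_apply, TensorProduct.sub_tmul, add_assoc, sub_add_cancel] at this
    · simp only [eqx, eqy, lie_neg, lie_smul, lie_add, lie_sub, lie_self, lie_zero, lie_e_f,
        lie_e_h]
      module

theorem exists_tet_leftInverse {σ : Tet F →ₗ⁅F⁆ Loop F}
    (hσ : ∀ (i j : Fin 4) (hij : i ≠ j), σ (gen F i j hij) = coord F (genVal F i j)) :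
    ∃ ψ : Loop F →ₗ⁅F⁆ Tet F, ∀ v, ψ (σ v) = v := by
  obtain ⟨P, Q, R, hP, hQ, hR, hp, hq, hr, hPQ, hQR, hRP⟩ := exists_families (F := F)
  have hx := sl2ToTet_eqx (F := F)
  have hy := sl2ToTet_eqy (F := F)
  have hz := sl2ToTet_eqz (F := F)
  generalize sl2ToTet F = ι at *
  have hcl := isClosedFamily_of_powers hP hQ hR hPQ hQR hRP fun K hι hKP hKQ hKR =>
    tet_subalgebra_eq_top (hx ▸ hι _) (hy ▸ hι _) (hz ▸ hι _) (hp ▸ K.sub_mem (hKP _) (hι _))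
      (hq ▸ K.sub_mem (hKQ _) (hι _)) (hr ▸ K.sub_mem (hKR _) (hι _))
  obtain ⟨ψ, hψ⟩ := hcl.exists_loop_hom (α := P 1) (β := Q 1) (γ := R 1) (by simp) (by simp)
    (by simp) hPQ hRP
  have h1 := fun s => (hψ s).1
  have ht := fun s => (hψ s).2.1
  have ht' := fun s => (hψ s).2.2.1
  have ht'' := fun s => (hψ s).2.2.2
  refine ⟨ψ, fun v => ?_⟩
  have : ψ.comp σ = LieHom.id := by
    apply tet_hom_ext <;> rw [LieHom.comp_apply, LieHom.id_apply, hσ]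
    · rw [coord_genVal_one_two, h1, hx]
    · rw [coord_genVal_two_three, h1, hy]
    · rw [coord_genVal_three_one, h1, hz]
    · rw [coord_genVal_zero_three, TensorProduct.sub_tmul, map_add, map_sub, ht, ht, h1, hp,
        map_add, add_sub_assoc]
    · rw [coord_genVal_zero_one, TensorProduct.sub_tmul, map_add, map_sub, ht', ht', h1, hq,
        map_add, add_sub_assoc]
    · rw [coord_genVal_zero_two, TensorProduct.sub_tmul, map_add, map_sub, ht'', ht'', h1, hr,
        map_add, add_sub_assoc]
  exact LieHom.congr_fun this v

/-- The isomorphism between the tetrahedron algebra and the three-point loop algebra. -/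
theorem exists_tet_equiv : ∃ σ : Tet F ≃ₗ⁅F⁆ Loop F,
    ∀ (i j : Fin 4) (hij : i ≠ j), σ (gen F i j hij) = coord F (genVal F i j) := by
  obtain ⟨σ, hσ⟩ := exists_tet_hom (F := F)
  obtain ⟨ψ, hψ⟩ := exists_tet_leftInverse hσ
  exact ⟨LieEquiv.ofBijective σ ⟨Function.LeftInverse.injective hψ,
    (LieHom.range_eq_top σ).1 (tet_hom_surjective hσ)⟩, hσ⟩

end Isomorphism

/-! ### Like elements as centralizers, and the direct sum. -/

section Like

variable {F : Type*} [Field F] {σ : Tet F ≃ₗ⁅F⁆ Loop F}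

theorem HasStandardValues.unique {τ : Tet F ≃ₗ⁅F⁆ Loop F} (hσ : HasStandardValues F σ)
    (hτ : HasStandardValues F τ) : τ = σ := by
  obtain ⟨h1, h2, h3, h4, h5, h6⟩ := hσ
  obtain ⟨k1, k2, k3, k4, k5, k6⟩ := hτ
  have : (τ : Tet F →ₗ⁅F⁆ Loop F) = (σ : Tet F →ₗ⁅F⁆ Loop F) :=
    tet_hom_ext (k1.trans h1.symm) (k2.trans h2.symm) (k3.trans h3.symm) (k4.trans h4.symm)
      (k5.trans h5.symm) (k6.trans h6.symm)
  exact LieEquiv.ext fun v => LieHom.congr_fun this v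

theorem hasStandardValues_of_coord
    (hσ : ∀ (i j : Fin 4) (hij : i ≠ j), σ (gen F i j hij) = coord F (genVal F i j)) :
    HasStandardValues F σ :=
  ⟨(hσ 1 2 _).trans (coord_genVal_one_two F), (hσ 2 3 _).trans (coord_genVal_two_three F),
    (hσ 3 1 _).trans (coord_genVal_three_one F), (hσ 0 3 _).trans (coord_genVal_zero_three F),
    (hσ 0 1 _).trans (coord_genVal_zero_one F), (hσ 0 2 _).trans (coord_genVal_zero_two F)⟩

theorem equiv_injective : Function.Injective σ := σ.injective

theorem equiv_surjective : Function.Surjective σ := σ.surjective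

theorem coord_eq_zero {v : A F × A F × A F} : coord F v = 0 ↔ v = 0 :=
  ⟨fun h => coord_injective (h.trans (map_zero _).symm), fun h => h ▸ map_zero _⟩

/-- In the loop algebra every element satisfies the Dolan-Grady condition with every standard
generator, by `cross_cross_cross`. -/
theorem isLike_iff
    (hσ : ∀ (i j : Fin 4) (hij : i ≠ j), σ (gen F i j hij) = coord F (genVal F i j))
    (i j : Fin 4) (hij : i ≠ j) (ξ : Tet F) :
    IsLike F i j hij ξ ↔ ⁅gen F i j hij, ξ⁆ = 0 := by
  refine ⟨fun h => h.1, fun h => ⟨h, fun m k hmk _ _ _ _ => equiv_injective (σ := σ) ?_⟩⟩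
  obtain ⟨v, hv⟩ := coord_surjective (σ ξ)
  rw [map_smul, LieEquiv.map_lie, LieEquiv.map_lie, LieEquiv.map_lie, hσ, ← hv, lie_coord,
    lie_coord, lie_coord, cross_cross_cross (genVal_norm F m k hmk), (coord F).map_smul_of_tower]

variable [CharZero F]

theorem isLike_iff_exists
    (hσ : ∀ (i j : Fin 4) (hij : i ≠ j), σ (gen F i j hij) = coord F (genVal F i j))
    (i j : Fin 4) (hij : i ≠ j) (ξ : Tet F) :
    IsLike F i j hij ξ ↔ ∃ a : A F, a • σ (gen F i j hij) = σ ξ := by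
  obtain ⟨v, hv⟩ := coord_surjective (σ ξ)
  rw [isLike_iff hσ, ← map_eq_zero_iff σ equiv_injective, LieEquiv.map_lie, hσ, ← hv, lie_coord,
    coord_eq_zero]
  constructor
  · intro h
    obtain ⟨a, rfl⟩ := eq_smul_of_cross_eq_zero (genVal_norm F i j hij) h
    exact ⟨a, (map_smul _ _ _).symm⟩
  · rintro ⟨a, ha⟩
    rw [← map_smul] at ha
    rw [← coord_injective ha, cross_smul_self]

theorem image_likeSet
    (hσ : ∀ (i j : Fin 4) (hij : i ≠ j), σ (gen F i j hij) = coord F (genVal F i j))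
    (i j : Fin 4) (hij : i ≠ j) :
    σ '' likeSet F i j hij = Set.range fun a : A F => a • σ (gen F i j hij) := by
  ext w
  constructor
  · rintro ⟨ξ, hξ, rfl⟩
    exact (isLike_iff_exists hσ i j hij ξ).1 hξ
  · rintro ⟨a, rfl⟩
    obtain ⟨ξ, hξ⟩ := equiv_surjective (σ := σ) (a • σ (gen F i j hij))
    exact ⟨ξ, (isLike_iff_exists hσ i j hij ξ).2 ⟨a, hξ.symm⟩, hξ⟩

theorem isInternal_like
    (hσ : ∀ (i j : Fin 4) (hij : i ≠ j), σ (gen F i j hij) = coord F (genVal F i j))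
    {X Y Z : Submodule F (Tet F)} (hX : (X : Set (Tet F)) = likeSet F 1 2)
    (hY : (Y : Set (Tet F)) = likeSet F 2 3) (hZ : (Z : Set (Tet F)) = likeSet F 3 1) :
    DirectSum.IsInternal ![X, Y, Z] := by
  have hv := hasStandardValues_of_coord hσ
  have mX : ∀ ξ, ξ ∈ X ↔ ∃ a : A F, coord F (2 * a, 0, -a) = σ ξ := fun ξ => by
    rw [← SetLike.mem_coe, hX]
    refine (isLike_iff_exists hσ _ _ _ _).trans (exists_congr fun a => ?_)
    rw [hv.1, TensorProduct.smul_tmul', smul_eq_mul, mul_one, tmul_eqx]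
  have mY : ∀ ξ, ξ ∈ Y ↔ ∃ a : A F, coord F (0, -(2 * a), -a) = σ ξ := fun ξ => by
    rw [← SetLike.mem_coe, hY]
    refine (isLike_iff_exists hσ _ _ _ _).trans (exists_congr fun a => ?_)
    rw [hv.2.1, TensorProduct.smul_tmul', smul_eq_mul, mul_one, tmul_eqy]
  have mZ : ∀ ξ, ξ ∈ Z ↔ ∃ a : A F, coord F (0, 0, a) = σ ξ := fun ξ => by
    rw [← SetLike.mem_coe, hZ]
    refine (isLike_iff_exists hσ _ _ _ _).trans (exists_congr fun a => ?_)
    rw [hv.2.2.1, TensorProduct.smul_tmul', smul_eq_mul, mul_one, tmul_eqz]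
  have h2 : ∀ a : A F, 2 * a = 0 → a = 0 := fun a ha => by
    have : (2 : F) • a = 0 := by rw [Algebra.smul_def, map_ofNat, ha]
    exact (smul_eq_zero.1 this).resolve_left two_ne_zero
  have sum_zero : ∀ u ∈ X, ∀ v ∈ Y, ∀ w ∈ Z, u + v + w = 0 → u = 0 ∧ v = 0 ∧ w = 0 := by
    intro u hu v hv w hw h
    obtain ⟨a, ha⟩ := (mX u).1 hu
    obtain ⟨b, hb⟩ := (mY v).1 hv
    obtain ⟨c, hc⟩ := (mZ w).1 hw
    have h0 := congrArg σ h
    rw [map_add, map_add, ← ha, ← hb, ← hc, ← map_add, ← map_add, map_zero,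
      coord_eq_zero] at h0
    simp only [Prod.mk_add_mk, Prod.mk_eq_zero, add_zero, zero_add, neg_eq_zero] at h0
    have ha0 := h2 a h0.1
    have hb0 := h2 b h0.2.1
    have hc0 := h0.2.2
    rw [ha0, hb0, neg_zero, zero_add, zero_add] at hc0
    rw [ha0, mul_zero, neg_zero] at ha
    rw [hb0, mul_zero, neg_zero] at hb
    rw [hc0] at hc
    exact ⟨equiv_injective (σ := σ) (by rw [← ha, map_zero]; exact map_zero _),
      equiv_injective (σ := σ) (by rw [← hb, map_zero]; exact map_zero _),
      equiv_injective (σ := σ) (by rw [← hc, map_zero]; exact map_zero _)⟩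
  apply DirectSum.isInternal_submodule_of_iSupIndep_of_iSup_eq_top
  · rw [iSupIndep_fin_three]
    refine ⟨?_, ?_, ?_⟩ <;> refine Submodule.disjoint_def.2 fun u hu hu' => ?_ <;>
      obtain ⟨v, hv, w, hw, rfl⟩ := Submodule.mem_sup.1 hu'
    · have := sum_zero _ hu _ (Y.neg_mem hv) _ (Z.neg_mem hw) (by abel)
      exact this.1
    · have := sum_zero _ (X.neg_mem hw) _ hu _ (Z.neg_mem hv) (by abel)
      exact this.2.1
    · have := sum_zero _ (X.neg_mem hv) _ (Y.neg_mem hw) _ hu (by abel)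
      exact this.2.2
  · rw [eq_top_iff]
    intro ξ _
    obtain ⟨⟨a, b, c⟩, hξ⟩ := coord_surjective (σ ξ)
    have half : ∀ a : A F, 2 * ((2⁻¹ : F) • a) = a := fun a => by
      have : (2 : F) • ((2⁻¹ : F) • a) = a := by
        rw [smul_smul, mul_inv_cancel₀ two_ne_zero, one_smul]
      rwa [Algebra.smul_def, map_ofNat] at this
    -- Only `x` involves `e` and only `y` involves `f`, so their coefficients must be `a / 2` and
    -- `-b / 2`; `z` absorbs the rest of the `h` coordinate.
    obtain ⟨u, hu⟩ := equiv_surjective (σ := σ) (coord F (2 * ((2⁻¹ : F) • a), 0, -((2⁻¹ : F) • a)))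
    obtain ⟨v, hv⟩ := equiv_surjective (σ := σ) (coord F (0, -(2 * ((2⁻¹ : F) • -b)), -((2⁻¹ : F) • -b)))
    obtain ⟨w, hw⟩ := equiv_surjective (σ := σ)
      (coord F (0, 0, c + (2⁻¹ : F) • a + (2⁻¹ : F) • -b))
    have hsum : ξ = u + v + w := by
      apply equiv_injective (σ := σ)
      rw [map_add, map_add, hu, hv, hw, ← hξ, ← map_add, ← map_add, half, half]
      congr 1
      simp only [Prod.mk_add_mk, Prod.mk.injEq]
      exact ⟨by ring, by ring, by ring⟩
    rw [hsum]
    refine Submodule.add_mem _ (Submodule.add_mem _ ?_ ?_) ?_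
    · exact Submodule.mem_iSup_of_mem (p := ![X, Y, Z]) 0 ((mX u).2 ⟨_, hu.symm⟩)
    · exact Submodule.mem_iSup_of_mem (p := ![X, Y, Z]) 1 ((mY v).2 ⟨_, hv.symm⟩)
    · exact Submodule.mem_iSup_of_mem (p := ![X, Y, Z]) 2 ((mZ w).2 ⟨_, hw.symm⟩)

end Like

end TetAlg

end

/-! ### Assembly of the two statements. -/

theorem mainTheorem2 (F : Type*) [Field F] [CharZero F] :
    -- each `X_{ij}` is a subspace, and `X_{12}, X_{23}, X_{31}` give a direct sum decomposition
    (∃ W : Fin 4 → Fin 4 → Submodule F (TetAlg.Tet F),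
      (∀ (i j : Fin 4) (hij : i ≠ j),
        (W i j : Set (TetAlg.Tet F)) = TetAlg.likeSet F i j hij) ∧
      DirectSum.IsInternal ![W 1 2, W 2 3, W 3 1]) ∧
    -- the isomorphism `σ` exists, is unique, and the images of the `X_{ij}` are as described
    (∃ σ : TetAlg.Tet F ≃ₗ⁅F⁆ TetAlg.Loop F,
      TetAlg.HasStandardValues F σ ∧
      (∀ τ : TetAlg.Tet F ≃ₗ⁅F⁆ TetAlg.Loop F, TetAlg.HasStandardValues F τ → τ = σ) ∧
      σ '' TetAlg.likeSet F 1 2 = Set.range (fun a : TetAlg.A F => a ⊗ₜ[F] TetAlg.eqx F) ∧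
      σ '' TetAlg.likeSet F 2 3 = Set.range (fun a : TetAlg.A F => a ⊗ₜ[F] TetAlg.eqy F) ∧
      σ '' TetAlg.likeSet F 3 1 = Set.range (fun a : TetAlg.A F => a ⊗ₜ[F] TetAlg.eqz F) ∧
      σ '' TetAlg.likeSet F 0 3 = Set.range (fun a : TetAlg.A F =>
        a • (TetAlg.t F ⊗ₜ[F] TetAlg.eqy F + (TetAlg.t F - 1) ⊗ₜ[F] TetAlg.eqz F)) ∧
      σ '' TetAlg.likeSet F 0 1 = Set.range (fun a : TetAlg.A F =>
        a • (TetAlg.t' F ⊗ₜ[F] TetAlg.eqz F + (TetAlg.t' F - 1) ⊗ₜ[F] TetAlg.eqx F)) ∧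
      σ '' TetAlg.likeSet F 0 2 = Set.range (fun a : TetAlg.A F =>
        a • (TetAlg.t'' F ⊗ₜ[F] TetAlg.eqx F + (TetAlg.t'' F - 1) ⊗ₜ[F] TetAlg.eqy F)) ∧
      (∀ (i j : Fin 4) (hij : i ≠ j),
        σ '' TetAlg.likeSet F i j hij =
          Set.range (fun a : TetAlg.A F => a • σ (TetAlg.gen F i j hij)))) := by
  obtain ⟨σ, hσ⟩ := TetAlg.exists_tet_equiv (F := F)
  have hv := TetAlg.hasStandardValues_of_coord hσ
  have him := TetAlg.image_likeSet hσ
  let W : Fin 4 → Fin 4 → Submodule F (TetAlg.Tet F) := fun i j =>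
    if hij : i ≠ j then LinearMap.ker (LieAlgebra.ad F _ (TetAlg.gen F i j hij)) else ⊥
  have hW : ∀ (i j : Fin 4) (hij : i ≠ j),
      (W i j : Set (TetAlg.Tet F)) = TetAlg.likeSet F i j hij := by
    intro i j hij
    ext ξ
    simp only [W, dif_pos hij]
    exact (TetAlg.isLike_iff hσ i j hij ξ).symm
  have hone : ∀ s : TetAlg.sl2 F, (fun a : TetAlg.A F => a • ((1 : TetAlg.A F) ⊗ₜ[F] s)) =
      fun a => a ⊗ₜ[F] s := fun s => by
    funext a
    rw [TensorProduct.smul_tmul', smul_eq_mul, mul_one]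
  refine ⟨⟨W, hW, TetAlg.isInternal_like hσ (hW _ _ _) (hW _ _ _) (hW _ _ _)⟩,
    σ, hv, fun τ hτ => hv.unique hτ, ?_, ?_, ?_, ?_, ?_, ?_, him⟩
  · rw [him, hv.1, hone]
  · rw [him, hv.2.1, hone]
  · rw [him, hv.2.2.1, hone]
  · rw [him, hv.2.2.2.1]
  · rw [him, hv.2.2.2.2.1]
  · rw [him, hv.2.2.2.2.2]
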